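/- All graphs are finite, simple and undirected; the null graph (no vertices) is allowed, and connected graphs are nonnull. The treedepth $\operatorname{td}(X)$ of a graph $X$ is defined recursively: $\operatorname{td}(X)=0$ if $X$ is the null graph; $\operatorname{td}(X)=1+\min_{v\in V(X)}\operatorname{td}(X-v)$ if $X$ is connected; and $\operatorname{td}(X)=\max_i \operatorname{td}(C_i)$ if $X$ has components $C_1,\dots,C_k$ with $k>1$. A graph $G$ is $X$-minor-free if $X$ is not a minor of $G$, where $X$ is a minor of $G$ if there are pairwise disjoint sets $B_x\subseteq V(G)$ $(x\in V(X))$ such that each $G[B_x]$ is connected and, for every edge $xy$ of $X$, some edge of $G$ joins $B_x$ and $B_y$. A tree decomposition of $G$ is a tree $T$ with sets $W_x\subseteq V(G)$ $(x\in V(T))$ such that, for every $u\in V(G)$, the subgraph $T[\{x: u\in W_x\}]$ is connected, and every edge $uv$ of $G$ satisfies $u,v\in W_x$ for some $x$; its width is $\max_x|W_x|-1$, and the treewidth $\operatorname{tw}(G)$ is the minimum width of a tree decomposition of $G$ (so $\operatorname{tw}=-1$ for the null graph). For a linear ordering $\sigma$ of $V(G)$, an integer $r\ge 0$ and $u\in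 V(G)$, let $\operatorname{WReach}_r[G,\sigma,u]$ be the set of vertices $v$ for which $G$ has a path between $u$ and $v$ with at most $r$ edges all of whose vertices $w$ satisfy $v\le_\sigma w$. The $r$-th weak coloring number of $G$ is $\operatorname{wcol}_r(G)=\min_\sigma\max_{u\in V(G)}|\operatorname{WReach}_r[G,\sigma,u]|$ (which is $0$ for the null graph). Theorem. For every integer $t\ge 2$ and every graph $X$ with $\operatorname{td}(X)\le t$, there exists an integer $c$ such that for every $X$-minor-free graph $G$ and every integer $r\ge 2$, $$\operatorname{wcol}_r(G)\le c\cdot(\operatorname{tw}(G)+1)\cdot r^{t-2}\log r .$$ -/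

import Mathlib

namespace WeakColoring

universe u v

/-- The vertex set (inside `V`) of a component of the induced subgraph `G[s]`. -/
def componentSet {V : Type u} (G : SimpleGraph V) (s : Set V)
    (C : (G.induce s).ConnectedComponent) : Set V :=
  Subtype.val '' C.supp

theorem componentSet_ncard_lt {V : Type u} [Finite V] (G : SimpleGraph V) (s : Set V)
    (hs : s ≠ ∅) (hc : ¬ (G.induce s).Connected) (C : (G.induce s).ConnectedComponent) :
    (componentSet G s C).ncard < s.ncard := by
  refine Set.ncard_lt_ncard ⟨?_, ?_⟩ (Set.toFinite s)
  · rintro _ ⟨x, -, rfl⟩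
    exact x.2
  · intro hsub
    apply hc
    have key : ∀ x : s, (G.induce s).connectedComponentMk x = C := by
      intro x
      obtain ⟨y, hy, hyx⟩ := hsub x.2
      have hxy : y = x := Subtype.ext hyx
      subst hxy
      exact hy
    obtain ⟨a, ha⟩ := Set.nonempty_iff_ne_empty.mpr hs
    have : Nonempty s := ⟨⟨a, ha⟩⟩
    exact ⟨fun x y => SimpleGraph.ConnectedComponent.exact ((key x).trans (key y).symm)⟩

open Classical in
/-- The treedepth of the induced subgraph `G[s]`: it is `0` if `s` is empty;
`min_{v ∈ s} td(G[s] - v) + 1` if `G[s]` is connected; and the maximum of the treedepths of the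
components of `G[s]` otherwise. (`Connected` includes having at least one vertex.) -/
noncomputable def treedepthOn {V : Type u} [Finite V] (G : SimpleGraph V) (s : Set V) : ℕ :=
  if hs : s = ∅ then 0
  else if hc : (G.induce s).Connected then (⨅ v : s, treedepthOn G (s \ {v.1})) + 1
  else ⨆ C : (G.induce s).ConnectedComponent, treedepthOn G (componentSet G s C)
termination_by s.ncard
decreasing_by
  · exact Set.ncard_sdiff_singleton_lt_of_mem v.2 (Set.toFinite s)
  · exact componentSet_ncard_lt G s hs hc C

/-- The treedepth of a finite graph. -/
noncomputable def treedepth {V : Type u} [Finite V] (G : SimpleGraph V) : ℕ :=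
  treedepthOn G Set.univ

/-- `B` is a model of `H` in `G`: pairwise disjoint branch sets inducing connected (in particular
nonempty) subgraphs of `G`, with an edge of `G` between `B x` and `B y` for each edge `xy` of
`H`. -/
structure IsModel {W : Type u} {V : Type v} (H : SimpleGraph W) (G : SimpleGraph V)
    (B : W → Set V) : Prop where
  disjoint : ∀ x y : W, x ≠ y → Disjoint (B x) (B y)
  connected : ∀ x : W, (G.induce (B x)).Connected
  adj : ∀ x y : W, H.Adj x y → ∃ a ∈ B x, ∃ b ∈ B y, G.Adj a b

/-- `H` is a minor of `G`. -/
def IsMinor {W : Type u} {V : Type v} (H : SimpleGraph W) (G : SimpleGraph V) : Prop :=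
  ∃ B : W → Set V, IsModel H G B

/-- The tree `T` together with the bags `W` is a tree decomposition of `G`. -/
structure IsTreeDecomposition {V : Type u} {N : Type v} (G : SimpleGraph V) (T : SimpleGraph N)
    (W : N → Set V) : Prop where
  isTree : T.IsTree
  connected : ∀ a : V, (T.induce {x : N | a ∈ W x}).Connected
  edge : ∀ a b : V, G.Adj a b → ∃ x : N, a ∈ W x ∧ b ∈ W x

/-- The width of a finite family of bags: the maximum size of a bag, minus one. -/
noncomputable def width {V : Type u} {N : Type v} (W : N → Set V) : ℤ :=
  ((⨆ x : N, (W x).ncard : ℕ) : ℤ) - 1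

/-- The treewidth of a finite graph: the minimum width of a tree decomposition whose tree is
finite (up to isomorphism, such a tree has vertex set `Fin n`). It is `-1` for the null graph. -/
noncomputable def treewidth {V : Type u} (G : SimpleGraph V) : ℤ :=
  sInf {k : ℤ | ∃ (n : ℕ) (T : SimpleGraph (Fin n)) (W : Fin n → Set V),
    IsTreeDecomposition G T W ∧ width W = k}

/-- The set of vertices weakly `r`-reachable from `a` in `(G, σ)`. -/
def wreach {V : Type u} (G : SimpleGraph V) (σ : LinearOrder V) (r : ℕ) (a : V) : Set V :=
  {b : V | ∃ p : G.Walk a b, p.IsPath ∧ p.length ≤ r ∧ ∀ w ∈ p.support, σ.le b w}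

/-- The `r`-th weak coloring number of a finite graph: the minimum over the orderings `σ` of the
vertices of the maximum over the vertices `a` of the number of vertices weakly `r`-reachable
from `a`. It is `0` for the null graph. -/
noncomputable def wcol {V : Type u} (G : SimpleGraph V) (r : ℕ) : ℕ :=
  ⨅ σ : LinearOrder V, ⨆ a : V, (wreach G σ r a).ncard

end WeakColoring

/-!
Treedepth at most `t` is used only through a universal graph: a graph on at most `k` vertices of
treedepth at most `t` is a subgraph of the closure of the `k`-ary forest of height `t` with `k`
roots. `HasRichModel` describes models of this closure in which every branch set contains a member
of a family `F` of connected sets, and `HasRichModel.exists_model` finds the given graph in them. In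
the absence of such a model of height `s + 2`, induction on `s` gives a set `S` that meets every
member of `F` and an ordering in which few vertices of `S` are weakly reachable from any vertex
(`hittingBound`). When `F` consists of all singletons, `S` is the whole vertex set.

Reachability is measured by `Reach`, where a walk pays only for its visits to `S`. Hence `S` acts
like its torso, and part of `S` may be discarded as long as the discarded vertices can be bypassed
at no cost through a connected set that avoids `S` (`exists_reachSet_sdiff_subset`).

The treewidth enters through `PackingBound`: in a graph with a tree decomposition into bags of size
at most `n`, a family of connected sets has `k` disjoint members or a hitting set of at most `k * n`
vertices. This is the whole proof for height `1`, where there is no adjacency to realise. For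
height `t + 1`, a set of at most `k * n` vertices meets all connected sets containing a rich model of
one tree of the forest, and the components `K` of the rest are treated separately. If `R ⊆ K` is
connected, then the rest of `K` has no rich model of height `t` for the family of connected sets
that contain a member of `F` and are adjacent to `R`, since `R` could be added as a root
(`hasCone_of_hasRichModel_attached`). So a hitting set of height `t` separates `R` from the members
of `F` beyond it; absorbing it into `R` and iterating from a single vertex produces levels, and a
walk pays for each level that it crosses.

* From height `1` to `2` the levels have bounded size. Keeping only the vertices accessible from `R`
  makes the levels a linear sequence (`exists_layered_of_ncard_le`), and ordering them by the
  power of two dividing their index costs a factor `O(log r)` (`IsLayered.reachBounded_of_dyadic`).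
* From height `2` on, each component that still contains a member of `F` is enlarged to its hull,
  the set of all vertices that it separates from `R`. The complement of a hull is connected and
  serves as the next root; maximal hulls are disjoint, and the vertices of the separator inside
  them can be discarded (`exists_maximal_hulls`). At most `r + 2` levels are within
  reach of a vertex, which costs a factor `O(r)` (`exists_layered_of_reachBounded`).
-/

namespace WeakColoring

universe u v w

/-! ### Connectivity inside a vertex set -/

section Reachability

variable {V : Type u} {G : SimpleGraph V}

/-- `u` and `v` are joined by a walk of `G` all of whose vertices lie in `A`. -/
def Linked (G : SimpleGraph V) (A : Set V) (u v : V) : Prop :=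
  ∃ p : G.Walk u v, ∀ w ∈ p.support, w ∈ A

/-- The set `A` is nonempty and induces a connected subgraph of `G`. -/
def ConnectedOn (G : SimpleGraph V) (A : Set V) : Prop :=
  A.Nonempty ∧ ∀ u ∈ A, ∀ v ∈ A, Linked G A u v

/-- The vertex set of the component of `u` in `G[A]`; it is empty if `u ∉ A`. -/
def compOn (G : SimpleGraph V) (A : Set V) (u : V) : Set V :=
  {w | Linked G A u w}

namespace Linked

variable {A B P : Set V} {u v w : V}

theorem refl (h : u ∈ A) : Linked G A u u :=
  ⟨.nil, by simpa using h⟩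

theorem mem_left (h : Linked G A u v) : u ∈ A :=
  h.choose_spec _ h.choose.start_mem_support

theorem mem_right (h : Linked G A u v) : v ∈ A :=
  h.choose_spec _ h.choose.end_mem_support

theorem symm (h : Linked G A u v) : Linked G A v u := by
  obtain ⟨p, hp⟩ := h
  exact ⟨p.reverse, by simpa using hp⟩

theorem trans (h : Linked G A u v) (h' : Linked G A v w) : Linked G A u w := by
  obtain ⟨p, hp⟩ := h
  obtain ⟨q, hq⟩ := h'
  refine ⟨p.append q, fun x hx => ?_⟩
  rw [SimpleGraph.Walk.mem_support_append_iff] at hx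
  exact hx.elim (hp x) (hq x)

theorem mono (h : Linked G A u v) (hAB : A ⊆ B) : Linked G B u v := by
  obtain ⟨p, hp⟩ := h
  exact ⟨p, fun x hx => hAB (hp x hx)⟩

theorem of_adj (hu : u ∈ A) (hv : v ∈ A) (h : G.Adj u v) : Linked G A u v :=
  ⟨.cons h .nil, by simp [hu, hv]⟩

/-- A walk inside `A` that starts in a set closed under adjacency within `A` never leaves it. -/
theorem restrict (h : Linked G A u v) (hu : u ∈ P)
    (hP : ∀ x ∈ A, x ∈ P → ∀ y ∈ A, G.Adj x y → y ∈ P) : Linked G (A ∩ P) u v := by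
  obtain ⟨p, hp⟩ := h
  induction p with
  | nil => exact refl ⟨hp _ (by simp), hu⟩
  | @cons a b c hab p ih =>
    have ha : a ∈ A := hp _ (by simp)
    have hb : b ∈ A := hp _ (by simp)
    have hbP := hP a ha hu b hb hab
    exact (of_adj (A := A ∩ P) ⟨ha, hu⟩ ⟨hb, hbP⟩ hab).trans
      (ih hbP fun w hw => hp w (by simp [hw]))

end Linked

variable {A B P R : Set V} {u v : V}

theorem ConnectedOn.subset_of_closed (h : ConnectedOn G A) (hu : u ∈ A) (huP : u ∈ P)
    (hP : ∀ x ∈ A, x ∈ P → ∀ y ∈ A, G.Adj x y → y ∈ P) : A ⊆ P :=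
  fun v hv => ((h.2 u hu v hv).restrict huP hP).mem_right.2

theorem compOn_subset : compOn G A u ⊆ A := fun _ h => h.mem_right

theorem mem_compOn_self (h : u ∈ A) : u ∈ compOn G A u := Linked.refl h

theorem compOn_closed {x y : V} (hx : x ∈ compOn G A u) (hy : y ∈ A) (h : G.Adj x y) :
    y ∈ compOn G A u :=
  Linked.trans hx (.of_adj hx.mem_right hy h)

theorem connectedOn_compOn (h : u ∈ A) : ConnectedOn G (compOn G A u) := by
  have key : ∀ v ∈ compOn G A u, Linked G (compOn G A u) u v := fun v hv =>
    (hv.restrict (P := compOn G A u) (mem_compOn_self h)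
      fun x _ hxP y hy hxy => compOn_closed hxP hy hxy).mono Set.inter_subset_right
  exact ⟨⟨u, mem_compOn_self h⟩, fun x hx y hy => (key x hx).symm.trans (key y hy)⟩

theorem compOn_eq_of_mem (h : v ∈ compOn G A u) : compOn G A v = compOn G A u :=
  Set.ext fun _ => ⟨fun hw => Linked.trans h hw, fun hw => (Linked.symm h).trans hw⟩

theorem ConnectedOn.subset_compOn (h : ConnectedOn G B) (hBA : B ⊆ A) (hu : u ∈ B) :
    B ⊆ compOn G A u := fun v hv => (h.2 u hu v hv).mono hBA

theorem connectedOn_singleton (u : V) : ConnectedOn G {u} :=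
  ⟨⟨u, rfl⟩, by rintro _ rfl _ rfl; exact .refl rfl⟩

theorem ConnectedOn.of_linked (h : ConnectedOn G R) (hRA : R ⊆ A)
    (hA : ∀ x ∈ A, ∃ y ∈ R, Linked G A x y) : ConnectedOn G A := by
  refine ⟨h.1.mono hRA, fun x hx y hy => ?_⟩
  obtain ⟨x', hx', hxx'⟩ := hA x hx
  obtain ⟨y', hy', hyy'⟩ := hA y hy
  exact hxx'.trans (((h.2 x' hx' y' hy').mono hRA).trans hyy'.symm)

theorem ConnectedOn.union (hA : ConnectedOn G A) (hB : ConnectedOn G B) (hu : u ∈ A) (hv : v ∈ B)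
    (h : G.Adj u v) : ConnectedOn G (A ∪ B) := by
  refine hA.of_linked Set.subset_union_left ?_
  rintro x (hx | hx)
  · exact ⟨x, hx, .refl (.inl hx)⟩
  · exact ⟨u, hu, ((hB.2 x hx v hv).mono Set.subset_union_right).trans
      (.of_adj (.inr hv) (.inl hu) h.symm)⟩

theorem linked_iff_reachable {x y : V} (hx : x ∈ A) (hy : y ∈ A) :
    Linked G A x y ↔ (G.induce A).Reachable ⟨x, hx⟩ ⟨y, hy⟩ := by
  have key : ∀ (x y : A) (_ : (G.induce A).Walk x y), Linked G A x y := by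
    intro x y p
    induction p with
    | nil => exact .refl (Subtype.property _)
    | cons hadj _ ih => exact (Linked.of_adj (Subtype.property _) (Subtype.property _) hadj).trans ih
  exact ⟨fun ⟨p, hp⟩ => ⟨p.induce A hp⟩, fun ⟨p⟩ => key _ _ p⟩

theorem connectedOn_iff : ConnectedOn G A ↔ (G.induce A).Connected := by
  constructor
  · rintro ⟨⟨a, ha⟩, h⟩
    have : Nonempty A := ⟨⟨a, ha⟩⟩
    exact ⟨fun x y => (linked_iff_reachable x.2 y.2).1 (h x x.2 y y.2)⟩
  · intro h
    obtain ⟨⟨a, ha⟩⟩ := h.nonempty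
    exact ⟨⟨a, ha⟩, fun x hx y hy => (linked_iff_reachable hx hy).2 (h.preconnected _ _)⟩

/-! ### Reachability that only pays for a set of vertices -/

/-- `Reach G A S q u b`: some walk of `G[A]` from `u` to `b` visits `S` at most `q` times, its two
ends included. Vertices outside `S` are free. -/
inductive Reach (G : SimpleGraph V) (A S : Set V) : ℕ → V → V → Prop
  | nil {q : ℕ} {u : V} : u ∈ A → (u ∈ S → 1 ≤ q) → Reach G A S q u u
  | free {q : ℕ} {u v b : V} : u ∈ A → u ∉ S → G.Adj u v → Reach G A S q v b → Reach G A S q u b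
  | pay {q : ℕ} {u v b : V} : u ∈ A → G.Adj u v → Reach G A S q v b → Reach G A S (q + 1) u b

namespace Reach

variable {S S' A' : Set V} {q q' : ℕ} {b : V}

theorem mem_left (h : Reach G A S q u b) : u ∈ A := by cases h <;> assumption

theorem mono (h : Reach G A S q u b) (hA : A ⊆ A') (hS : S' ⊆ S) (hq : q ≤ q') :
    Reach G A' S' q' u b := by
  induction h generalizing q' with
  | nil hu hq' => exact .nil (hA hu) fun h => (hq' (hS h)).trans hq
  | free hu huS hadj _ ih => exact .free (hA hu) (fun h => huS (hS h)) hadj (ih hq)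
  | pay hu hadj _ ih =>
    obtain ⟨q', rfl⟩ : ∃ m, q' = m + 1 := ⟨q' - 1, by omega⟩
    exact .pay (hA hu) hadj (ih (by omega))

/-- If the walk cannot cross the boundary of `P`, it stays in `P`. -/
theorem restrict (h : Reach G A S q u b) (hb : b ∈ P)
    (hP : ∀ x ∈ A, x ∈ P → ∀ y ∈ A, G.Adj x y → y ∈ P) : Reach G (A ∩ P) S q u b := by
  induction h with
  | nil hu hq => exact .nil ⟨hu, hb⟩ hq
  | free hu huS hadj h ih =>
    have := ih hb
    exact .free ⟨hu, hP _ h.mem_left this.mem_left.2 _ hu hadj.symm⟩ huS hadj this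
  | pay hu hadj h ih =>
    have := ih hb
    exact .pay ⟨hu, hP _ h.mem_left this.mem_left.2 _ hu hadj.symm⟩ hadj this

theorem of_linked {A₀ : Set V} (h : Linked G A₀ u v) (hA : A₀ ⊆ A) (hS : Disjoint A₀ S)
    (hv : Reach G A S q v b) : Reach G A S q u b := by
  obtain ⟨p, hp⟩ := h
  induction p with
  | nil => exact hv
  | cons hadj p ih =>
    have hu := hp _ (SimpleGraph.Walk.start_mem_support _)
    exact .free (hA hu) (Set.disjoint_left.1 hS hu) hadj
      (ih hv fun w hw => hp w (by simp [hw]))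

theorem of_walk {w : V} (p : G.Walk u w) (hp : ∀ x ∈ p.support, x ∈ A) :
    Reach G A S (p.length + 1) u w := by
  induction p with
  | nil => exact .nil (hp _ (by simp)) fun _ => by simp
  | cons hadj p ih => exact .pay (hp _ (by simp)) hadj (ih fun x hx => hp x (by simp [hx]))

end Reach

/-- The vertices `b` of `S` that can be reached from `u` inside `A` at cost at most `q` without
meeting a vertex of `S` of key smaller than `κ b`. -/
def reachSet (G : SimpleGraph V) (A S : Set V) (κ : V → ℕ) (q : ℕ) (u : V) : Set V :=
  {b | b ∈ S ∧ Reach G (A \ {w | w ∈ S ∧ κ w < κ b}) S q u b}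

/-- For some choice of keys, all the sets `reachSet G A S κ q u` have at most `B` elements. The keys
need not be distinct. -/
def ReachBounded (G : SimpleGraph V) (A S : Set V) (q B : ℕ) : Prop :=
  ∃ κ : V → ℕ, ∀ u, (reachSet G A S κ q u).ncard ≤ B

theorem ReachBounded.mono {A S : Set V} {q B B' : ℕ} (h : ReachBounded G A S q B) (hB : B ≤ B') :
    ReachBounded G A S q B' := by
  obtain ⟨κ, hκ⟩ := h
  exact ⟨κ, fun u => (hκ u).trans hB⟩

variable [Finite V]

/-- Giving the smallest keys to a set `Z` adds at most `|Z|` to the bound. -/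
theorem ReachBounded.union_first {A Z S : Set V} {q B : ℕ} (h : ReachBounded G (A \ Z) S q B) : ReachBounded G A (Z ∪ S) q (Z.ncard + B) := by
  classical
  obtain ⟨κ, hκ⟩ := h
  refine ⟨fun w => if w ∈ Z then 0 else κ w + 1, fun u => ?_⟩
  refine (Set.ncard_le_ncard (t := Z ∪ reachSet G (A \ Z) S κ q u) ?_ (Set.toFinite _)).trans
    ((Set.ncard_union_le _ _).trans (Nat.add_le_add_left (hκ u) _))
  rintro b ⟨hb, hr⟩
  by_cases hbZ : b ∈ Z
  · exact .inl hbZ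
  have hbS := hb.resolve_left hbZ
  refine .inr ⟨hbS, hr.mono ?_ Set.subset_union_right le_rfl⟩
  rintro w ⟨hwA, hw⟩
  have hwZ : w ∉ Z := fun hwZ => hw ⟨.inl hwZ, by simp [hwZ, hbZ]⟩
  refine ⟨⟨hwA, hwZ⟩, fun hw' => hw ⟨.inr hw'.1, ?_⟩⟩
  simpa [hwZ, hbZ] using hw'.2

/-- Bounds on the components of `G[A]` combine into a bound on `A`. -/
theorem ReachBounded.of_components {A : Set V} {q B : ℕ} (S : Set V → Set V)
    (hS : ∀ K, S K ⊆ K)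
    (h : ∀ u ∈ A, ReachBounded G (compOn G A u) (S (compOn G A u)) q B) :
    ReachBounded G A {b | b ∈ A ∧ b ∈ S (compOn G A b)} q B := by
  classical
  have h' : ∀ K : Set V, ∃ κ : V → ℕ, (∃ u ∈ A, K = compOn G A u) →
      ∀ u, (reachSet G K (S K) κ q u).ncard ≤ B := by
    intro K
    by_cases hK : ∃ u ∈ A, K = compOn G A u
    · obtain ⟨u, hu, rfl⟩ := hK
      obtain ⟨κ, hκ⟩ := h u hu
      exact ⟨κ, fun _ => hκ⟩
    · exact ⟨fun _ => 0, fun h => absurd h hK⟩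
  choose κ hκ using h'
  refine ⟨fun w => κ (compOn G A w) w, fun u => ?_⟩
  by_cases hu : u ∈ A
  · refine (Set.ncard_le_ncard (fun b hb => ?_) (Set.toFinite _)).trans
      (hκ _ ⟨u, hu, rfl⟩ u)
    obtain ⟨⟨hbA, hb⟩, hr⟩ := hb
    have hr' := hr.restrict (P := compOn G A b) (mem_compOn_self hbA)
      fun x _ hxP y hy hxy => compOn_closed hxP hy.1 hxy
    have heq := compOn_eq_of_mem hr'.mem_left.2
    rw [heq]
    refine ⟨hb, hr'.mono ?_ ?_ le_rfl⟩
    · rintro w ⟨⟨hwA, hw⟩, hwb⟩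
      refine ⟨hwb, fun hw' => hw ⟨⟨hwA, ?_⟩, ?_⟩⟩
      · rw [compOn_eq_of_mem hwb]; exact hw'.1
      · simpa only [compOn_eq_of_mem hwb] using hw'.2
    · intro w hw
      have hwb : w ∈ compOn G A b := hS _ hw
      exact ⟨hwb.mem_right, by rwa [compOn_eq_of_mem hwb]⟩
  · have : reachSet G A {b | b ∈ A ∧ b ∈ S (compOn G A b)}
        (fun w => κ (compOn G A w) w) q u = ∅ :=
      Set.eq_empty_of_forall_notMem fun b hb => hu hb.2.mem_left.1
    rw [this]; simp

end Reachability

/-! ### Hulls of separators -/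

section Hulls

variable {V : Type u} {G : SimpleGraph V}

/-- The vertices of `K` that `C` separates from `R` in `G[K]`, those of `C` included. -/
def hull (G : SimpleGraph V) (K R C : Set V) : Set V :=
  {x | x ∈ K ∧ ∀ y ∈ R, ¬ Linked G (K \ C) x y}

section Hull

variable {K R C C₁ C₂ : Set V}

theorem subset_hull (hC : C ⊆ K) : C ⊆ hull G K R C :=
  fun _ hx => ⟨hC hx, fun _ _ h => h.mem_left.2 hx⟩

theorem mem_of_adj_hull {x y : V} (hx : x ∈ K) (hxC : x ∉ hull G K R C)
    (hy : y ∈ hull G K R C) (h : G.Adj x y) : y ∈ C := by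
  by_contra hyC
  apply hxC
  refine ⟨hx, fun z hz hl => hy.2 z hz ?_⟩
  exact (Linked.of_adj (A := K \ C) ⟨hy.1, hyC⟩ hl.mem_left h.symm).trans hl

theorem disjoint_hull (hRK : R ⊆ K) (hRC : Disjoint R C) : Disjoint R (hull G K R C) :=
  Set.disjoint_left.2 fun x hx h =>
    h.2 x hx (.refl ⟨hRK hx, Set.disjoint_left.1 hRC hx⟩)

theorem connectedOn_sdiff_hull (hR : ConnectedOn G R) (hRK : R ⊆ K) (hRC : Disjoint R C) :
    ConnectedOn G (K \ hull G K R C) := by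
  refine hR.of_linked (fun x hx => ⟨hRK hx, Set.disjoint_left.1 (disjoint_hull hRK hRC) hx⟩) ?_
  rintro x ⟨hxK, hx⟩
  have : ∃ y ∈ R, Linked G (K \ C) x y := by
    by_contra! h
    exact hx ⟨hxK, h⟩
  obtain ⟨y, hy, hl⟩ := this
  refine ⟨y, hy, (hl.restrict (P := K \ hull G K R C) ⟨hxK, hx⟩ ?_).mono Set.inter_subset_right⟩
  rintro a ha haP b hb hab
  exact ⟨hb.1, fun hbh => hb.2 (mem_of_adj_hull haP.1 haP.2 hbh hab)⟩

theorem hull_subset_hull (hC : ConnectedOn G C₂) (hC₂ : C₂ ⊆ K) (hd : Disjoint C₁ C₂)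
    (hne : (C₂ ∩ hull G K R C₁).Nonempty) : hull G K R C₂ ⊆ hull G K R C₁ := by
  obtain ⟨z, hz, hzh⟩ := hne
  have hsub : C₂ ⊆ hull G K R C₁ := hC.subset_of_closed hz hzh fun x hx hxh y hy hxy => by
    by_contra hyh
    exact Set.disjoint_left.1 hd (mem_of_adj_hull (hC₂ hy) hyh hxh hxy.symm) hx
  rintro x ⟨hxK, hx⟩
  refine ⟨hxK, fun y hy hl => hx y hy ?_⟩
  by_contra hno
  have hxh : x ∉ hull G K R C₁ := fun h => h.2 y hy hl
  refine hno ((hl.restrict (P := (hull G K R C₁)ᶜ) hxh ?_).mono ?_)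
  · intro a ha haP b hb hab hbh
    exact hb.2 (mem_of_adj_hull ha.1 haP hbh hab)
  · exact fun a ha => ⟨ha.1.1, fun haC => ha.2 (hsub haC)⟩

/-- Hulls of disjoint connected sets form a laminar family. -/
theorem hull_laminar (hK : ConnectedOn G K) (hR : R.Nonempty) (hRK : R ⊆ K)
    (hC₁ : ConnectedOn G C₁) (hC₂ : ConnectedOn G C₂) (hC₁K : C₁ ⊆ K) (hC₂K : C₂ ⊆ K)
    (hRC₁ : Disjoint R C₁) (hd : Disjoint C₁ C₂) :
    Disjoint (hull G K R C₁) (hull G K R C₂) ∨ hull G K R C₁ ⊆ hull G K R C₂ ∨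
      hull G K R C₂ ⊆ hull G K R C₁ := by
  by_cases h₁ : (C₁ ∩ hull G K R C₂).Nonempty
  · exact .inr (.inl (hull_subset_hull hC₁ hC₁K hd.symm h₁))
  by_cases h₂ : (C₂ ∩ hull G K R C₁).Nonempty
  · exact .inr (.inr (hull_subset_hull hC₂ hC₂K hd h₂))
  refine .inl (Set.disjoint_left.2 fun x hx₁ hx₂ => ?_)
  -- The intersection of the hulls would be closed under adjacency, hence contain `R`.
  have hsub : K ⊆ hull G K R C₁ ∩ hull G K R C₂ := by
    refine hK.subset_of_closed hx₁.1 ⟨hx₁, hx₂⟩ fun a _ ha b hb hab => ?_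
    refine ⟨?_, ?_⟩
    · by_contra hbh
      exact h₁ ⟨a, mem_of_adj_hull hb hbh ha.1 hab.symm, ha.2⟩
    · by_contra hbh
      exact h₂ ⟨a, mem_of_adj_hull hb hbh ha.2 hab.symm, ha.1⟩
  obtain ⟨y, hy⟩ := hR
  exact Set.disjoint_left.1 (disjoint_hull hRK hRC₁) hy (hsub (hRK hy)).1

/-- The maximal hulls of a set `𝓑` of components of `G[E \ S]` that are not adjacent to `K \ E`. -/
theorem exists_maximal_hulls [Finite V] {E S : Set V} (hK : ConnectedOn G K) (hEK : E ⊆ K)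
    (hR : ConnectedOn G (K \ E)) (𝓑 : Set (Set V))
    (h𝓑 : ∀ C ∈ 𝓑, (∃ u ∈ E \ S, C = compOn G (E \ S) u) ∧
      ∀ x ∈ C, ∀ y ∈ K \ E, ¬ G.Adj x y) :
    ∃ (𝓜 : Set (Set V)) (core : Set V → Set V),
      (∀ M ∈ 𝓜, ∀ N ∈ 𝓜, ∀ x ∈ M, x ∈ N → M = N) ∧
      (∀ M ∈ 𝓜, M ⊆ E ∧ M.ncard < E.ncard ∧ ConnectedOn G (K \ M) ∧
        core M ⊆ E ∧ Disjoint (core M) S ∧ ConnectedOn G (core M) ∧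
        ∀ x ∈ K, x ∉ M → ∀ y ∈ M, G.Adj x y → y ∈ core M ∧ x ∈ S ∧ ∀ N ∈ 𝓜, x ∉ N) ∧
      ∀ C ∈ 𝓑, ∃ M ∈ 𝓜, C ⊆ M := by
  classical
  set R := K \ E with hRdef
  have hRK : R ⊆ K := Set.sdiff_subset
  have hsub : ∀ C ∈ 𝓑, C ⊆ E \ S := fun C hC => by
    obtain ⟨⟨u, -, rfl⟩, -⟩ := h𝓑 C hC
    exact compOn_subset
  have hconn : ∀ C ∈ 𝓑, ConnectedOn G C := fun C hC => by
    obtain ⟨⟨u, hu, rfl⟩, -⟩ := h𝓑 C hC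
    exact connectedOn_compOn hu
  have hclosed : ∀ C ∈ 𝓑, ∀ x ∈ C, ∀ y ∈ E \ S, G.Adj x y → y ∈ C := fun C hC => by
    obtain ⟨⟨u, hu, rfl⟩, -⟩ := h𝓑 C hC
    exact fun x hx y hy hxy => compOn_closed hx hy hxy
  have hRC : ∀ C ∈ 𝓑, Disjoint R C := fun C hC =>
    Set.disjoint_left.2 fun x hx hxC => hx.2 (hsub C hC hxC).1
  have hCK : ∀ C ∈ 𝓑, C ⊆ K := fun C hC => (hsub C hC).trans (Set.sdiff_subset.trans hEK)
  have hdisj : ∀ C ∈ 𝓑, ∀ D ∈ 𝓑, C ≠ D → Disjoint C D := fun C hC D hD hne => by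
    obtain ⟨⟨u, -, rfl⟩, -⟩ := h𝓑 C hC
    obtain ⟨⟨v, -, rfl⟩, -⟩ := h𝓑 D hD
    refine Set.disjoint_left.2 fun x hx hx' => hne ?_
    rw [← compOn_eq_of_mem hx, compOn_eq_of_mem hx']
  have hlam : ∀ C ∈ 𝓑, ∀ D ∈ 𝓑, Disjoint (hull G K R C) (hull G K R D) ∨
      hull G K R C ⊆ hull G K R D ∨ hull G K R D ⊆ hull G K R C := fun C hC D hD => by
    by_cases hCD : C = D
    · subst hCD; exact .inr (.inl le_rfl)
    · exact hull_laminar hK hR.1 hRK (hconn C hC) (hconn D hD) (hCK C hC) (hCK D hD) (hRC C hC)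
        (hdisj C hC D hD hCD)
  have hbd : ∀ C ∈ 𝓑, ∀ x ∈ K, x ∉ hull G K R C → ∀ y ∈ hull G K R C, G.Adj x y →
      y ∈ C ∧ x ∈ S := fun C hC x hx hxh y hy hxy => by
    have hyC := mem_of_adj_hull hx hxh hy hxy
    refine ⟨hyC, ?_⟩
    by_contra hxS
    have hxE : x ∈ E := by
      by_contra hxE
      exact (h𝓑 C hC).2 y hyC x ⟨hx, hxE⟩ hxy.symm
    exact hxh (subset_hull (hCK C hC) (hclosed C hC y hyC x ⟨hxE, hxS⟩ hxy.symm))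
  set 𝓗 : Set (Set V) := hull G K R '' 𝓑 with h𝓗
  set 𝓜 : Set (Set V) := {M | Maximal (· ∈ 𝓗) M} with h𝓜
  have hpre : ∀ M : Set V, ∃ C : Set V, M ∈ 𝓗 → C ∈ 𝓑 ∧ hull G K R C = M := fun M => by
    by_cases hM : M ∈ 𝓗
    · obtain ⟨C, hC⟩ := hM
      exact ⟨C, fun _ => hC⟩
    · exact ⟨∅, fun h => absurd h hM⟩
  choose core hcore using hpre
  have h1 : ∀ M ∈ 𝓜, ∀ N ∈ 𝓜, ∀ x ∈ M, x ∈ N → M = N := fun M hM N hN x hxM hxN => by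
    obtain ⟨hC, hCM⟩ := hcore M hM.1
    obtain ⟨hD, hDN⟩ := hcore N hN.1
    have := hlam _ hC _ hD
    rw [hCM, hDN] at this
    rcases this with h | h | h
    · exact absurd hxN (Set.disjoint_left.1 h hxM)
    · exact hM.eq_of_le hN.1 h
    · exact (hN.eq_of_le hM.1 h).symm
  refine ⟨𝓜, core, h1, fun M hM => ?_, fun C hC => ?_⟩
  · obtain ⟨hC, hCM⟩ := hcore M hM.1
    have hME : M ⊆ E := fun x hx => by
      by_contra hxE
      rw [← hCM] at hx
      exact Set.disjoint_left.1 (disjoint_hull hRK (hRC _ hC)) ⟨hx.1, hxE⟩ hx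
    refine ⟨hME, Set.ncard_lt_ncard (hME.ssubset_of_ne fun hEq => ?_) (Set.toFinite _),
      hCM ▸ connectedOn_sdiff_hull hR hRK (hRC _ hC), (hsub _ hC).trans Set.sdiff_subset,
      Set.disjoint_left.2 fun x hx => (hsub _ hC hx).2, hconn _ hC, fun x hx hxM y hy hxy => ?_⟩
    · -- A maximal hull equal to `E` would make `R` closed under adjacency in `K`.
      obtain ⟨r, hr⟩ := hR.1
      have hKR : K ⊆ R := hK.subset_of_closed hr.1 hr fun x hx hxR y hy hxy => by
        refine ⟨hy, fun hyE => ?_⟩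
        rw [← hEq, ← hCM] at hyE
        exact (h𝓑 _ hC).2 y (mem_of_adj_hull hx (Set.disjoint_left.1
          (disjoint_hull hRK (hRC _ hC)) hxR) hyE hxy) x hxR hxy.symm
      obtain ⟨c, hc⟩ := (hconn _ hC).1
      exact (hKR (hCK _ hC hc)).2 (hsub _ hC hc).1
    · have hb := hbd _ hC x hx (by rwa [hCM]) y (by rwa [hCM]) hxy
      refine ⟨hb.1, hb.2, fun N hN hxN => ?_⟩
      obtain ⟨hD, hDN⟩ := hcore N hN.1
      have hyN : y ∉ N := fun hyN => hxM (h1 M hM N hN y hy hyN ▸ hxN)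
      have := hbd _ hD y (hCK _ hC hb.1) (by rwa [hDN]) x (by rwa [hDN]) hxy.symm
      exact (hsub _ hD this.1).2 hb.2
  · obtain ⟨M, hCM, hM⟩ := (Set.toFinite 𝓗).exists_le_maximal (Set.mem_image_of_mem _ hC)
    exact ⟨M, hM, (subset_hull (hCK C hC)).trans hCM⟩

end Hull

/-- Dropping from `S` the vertices inside sets `M ∈ 𝓜` does not enlarge the sets of reachable
vertices, provided each `M` has a connected core free of `S` through which it can be entered only
from `S`: a walk inside `M` may then be replaced by a walk inside the core, which costs nothing. -/
theorem exists_reachSet_sdiff_subset {E S : Set V} (𝓜 : Set (Set V)) (core : Set V → Set V)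
    (hcE : ∀ M ∈ 𝓜, core M ⊆ E) (hcS : ∀ M ∈ 𝓜, Disjoint (core M) S)
    (hcc : ∀ M ∈ 𝓜, ConnectedOn G (core M))
    (hbd : ∀ M ∈ 𝓜, ∀ x ∈ E, x ∉ M → ∀ y ∈ M, G.Adj x y →
      y ∈ core M ∧ x ∈ S ∧ ∀ N ∈ 𝓜, x ∉ N)
    (κ : V → ℕ) (q : ℕ) (u : V) :
    ∃ u', reachSet G E (S \ ⋃₀ 𝓜) κ q u ⊆ reachSet G E S κ q u' := by
  have key : ∀ m, ∀ b ∈ S \ ⋃₀ 𝓜, ∀ {q : ℕ} {u : V},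
      Reach G (E \ {w | w ∈ S \ ⋃₀ 𝓜 ∧ κ w < m}) (S \ ⋃₀ 𝓜) q u b →
      (u ∉ ⋃₀ 𝓜 → Reach G (E \ {w | w ∈ S ∧ κ w < m}) S q u b) ∧
      ∀ M ∈ 𝓜, u ∈ M → ∀ c ∈ core M, Reach G (E \ {w | w ∈ S ∧ κ w < m}) S q c b := by
    intro m b hb q u h
    have hsub : ∀ M ∈ 𝓜, core M ⊆ E \ {w | w ∈ S ∧ κ w < m} := fun M hM x hx =>
      ⟨hcE M hM hx, fun h => Set.disjoint_left.1 (hcS M hM) hx h.1⟩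
    have hout : ∀ {x : V}, x ∈ E \ {w | w ∈ S \ ⋃₀ 𝓜 ∧ κ w < m} → x ∉ ⋃₀ 𝓜 →
        x ∈ E \ {w | w ∈ S ∧ κ w < m} := fun hx hxM =>
      ⟨hx.1, fun h => hx.2 ⟨⟨h.1, hxM⟩, h.2⟩⟩
    -- A step that starts in `M` is replaced by a walk in its core.
    have hin : ∀ {x y : V} {q : ℕ}, x ∈ E → y ∈ E → G.Adj x y →
        ((y ∉ ⋃₀ 𝓜 → Reach G (E \ {w | w ∈ S ∧ κ w < m}) S q y b) ∧
          ∀ M ∈ 𝓜, y ∈ M → ∀ c ∈ core M, Reach G (E \ {w | w ∈ S ∧ κ w < m}) S q c b) →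
        ∀ M ∈ 𝓜, x ∈ M → ∀ c ∈ core M, Reach G (E \ {w | w ∈ S ∧ κ w < m}) S q c b := by
      intro x y q hx hy hxy ih M hM hxM c hc
      by_cases hyM : y ∈ M
      · exact ih.2 M hM hyM c hc
      · obtain ⟨hxc, -, hyN⟩ := hbd M hM y hy hyM x hxM hxy.symm
        refine .of_linked ((hcc M hM).2 c hc x hxc) (hsub M hM) (hcS M hM) ?_
        exact .free (hsub M hM hxc) (Set.disjoint_left.1 (hcS M hM) hxc) hxy
          (ih.1 fun ⟨N, hN, hy⟩ => hyN N hN hy)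
    induction h with
    | nil hu hq =>
      exact ⟨fun huM => .nil (hout hu huM) fun huS => hq ⟨huS, huM⟩,
        fun M hM huM => absurd ⟨M, hM, huM⟩ hb.2⟩
    | @free q u v b hu huS hadj h ih =>
      have ih := ih hb hin
      refine ⟨fun huM => ?_, hin hu.1 h.mem_left.1 hadj ih⟩
      have huS' : u ∉ S := fun h => huS ⟨h, huM⟩
      refine .free (hout hu huM) huS' hadj (ih.1 ?_)
      rintro ⟨M, hM, hv⟩
      exact huS' (hbd M hM u hu.1 (fun h => huM ⟨M, hM, h⟩) v hv hadj).2.1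
    | @pay q u v b hu hadj h ih =>
      have ih := ih hb hin
      refine ⟨fun huM => ?_, fun M hM huM c hc =>
        (hin hu.1 h.mem_left.1 hadj ih M hM huM c hc).mono le_rfl le_rfl (Nat.le_succ _)⟩
      by_cases hv : v ∈ ⋃₀ 𝓜
      · obtain ⟨M, hM, hv⟩ := hv
        have hvc := (hbd M hM u hu.1 (fun h => huM ⟨M, hM, h⟩) v hv hadj).1
        exact .pay (hout hu huM) hadj (ih.2 M hM hv v hvc)
      · exact .pay (hout hu huM) hadj (ih.1 hv)
  by_cases hu : u ∈ ⋃₀ 𝓜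
  · obtain ⟨M, hM, hu⟩ := hu
    obtain ⟨c, hc⟩ := (hcc M hM).1
    exact ⟨c, fun b hb => ⟨hb.1.1, (key _ b hb.1 hb.2).2 M hM hu c hc⟩⟩
  · exact ⟨u, fun b hb => ⟨hb.1.1, (key _ b hb.1 hb.2).1 hu⟩⟩

end Hulls

/-! ### Layered hitting sets -/

section Layers

variable {V : Type u} {G : SimpleGraph V}

/-- Some edge of `G` joins `f` and `R`. -/
def Touches (G : SimpleGraph V) (f R : Set V) : Prop :=
  ∃ x ∈ f, ∃ y ∈ R, G.Adj x y

/-- The connected sets that contain a member of `F` and are adjacent to `R`. -/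
def attached (G : SimpleGraph V) (F : Set (Set V)) (R : Set V) : Set (Set V) :=
  {f | ConnectedOn G f ∧ (∃ g ∈ F, g ⊆ f) ∧ Touches G f R}

/-- `S ⊆ E` meets every member of `F` inside `E`, and `δ` is a depth function on `E` for which `S`
is a union of separating levels: depth is `0` next to `K \ E`, and along an edge the depth grows
only on leaving a vertex of `S`, and then by one. -/
structure IsLayered (G : SimpleGraph V) (K : Set V) (F : Set (Set V)) (E S : Set V)
    (δ : V → ℕ) : Prop where
  subset : S ⊆ E
  hits : ∀ f ∈ F, f ⊆ E → (f ∩ S).Nonempty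
  base : ∀ u ∈ E, ∀ v ∈ K, v ∉ E → G.Adj u v → δ u = 0
  step : ∀ u ∈ E, ∀ v ∈ E, G.Adj u v → δ u ≤ δ v + 1 ∧ (v ∉ S → δ u ≤ δ v)

variable {K E S T : Set V} {F : Set (Set V)} {δ : V → ℕ} {A : Set V} {q : ℕ} {u b : V}

/-- A walk that ends in `S` pays for every unit by which its depth decreases. -/
theorem IsLayered.depth_le_add (h : IsLayered G K F E S δ) (hA : A ⊆ E) (hb : b ∈ S)
    (hr : Reach G A S q u b) : δ u ≤ δ b + q ∧ (u ∈ S → δ u + 1 ≤ δ b + q) := by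
  induction hr with
  | nil _ hq => exact ⟨by omega, fun hu => by have := hq hu; omega⟩
  | @free q u v b hu huS hadj hr ih =>
    have ih := ih hb
    have hs := h.step u (hA hu) v (hA hr.mem_left) hadj
    refine ⟨?_, fun h => absurd h huS⟩
    by_cases hv : v ∈ S
    · have := ih.2 hv; omega
    · have := hs.2 hv; omega
  | @pay q u v b hu hadj hr ih =>
    have ih := ih hb
    have hs := h.step u (hA hu) v (hA hr.mem_left) hadj
    have : δ u ≤ δ b + q := by
      by_cases hv : v ∈ S
      · have := ih.2 hv; omega
      · have := hs.2 hv; omega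
    omega

/-- A walk that ends in `S` pays for every unit by which its depth increases, and for its end. -/
theorem IsLayered.depth_lt_add (h : IsLayered G K F E S δ) (hA : A ⊆ E) (hb : b ∈ S)
    (hr : Reach G A S q u b) : δ b < δ u + q := by
  induction hr with
  | nil _ hq => have := hq hb; omega
  | @free q u v b hu huS hadj hr ih =>
    have ih := ih hb
    have hs := (h.step v (hA hr.mem_left) u (hA hu) hadj.symm).2 huS
    omega
  | @pay q u v b hu hadj hr ih =>
    have ih := ih hb
    have hs := (h.step v (hA hr.mem_left) u (hA hu) hadj.symm).1
    omega

/-- A walk that ascends passes through `S` at every depth in between. -/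
theorem IsLayered.exists_mem_up (h : IsLayered G K F E S δ) (hA : A ⊆ E) (hb : b ∈ S)
    (hr : Reach G A S q u b) {y : ℕ} (huy : δ u ≤ y) (hyb : y ≤ δ b) :
    ∃ w ∈ A, w ∈ S ∧ δ w = y := by
  have main : ∀ {u v b : V} {q : ℕ}, u ∈ A → G.Adj u v → Reach G A S q v b → δ u ≤ y →
      (δ v ≤ y → ∃ w ∈ A, w ∈ S ∧ δ w = y) → ∃ w ∈ A, w ∈ S ∧ δ w = y := by
    intro u v b q hu hadj hr huy ih
    by_cases hvy : δ v ≤ y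
    · exact ih hvy
    have hs := h.step v (hA hr.mem_left) u (hA hu) hadj.symm
    by_cases huS : u ∈ S
    · exact ⟨u, hu, huS, by omega⟩
    · have := hs.2 huS; omega
  induction hr with
  | @nil q u hu hq => exact ⟨u, hu, hb, by omega⟩
  | free hu _ hadj hr ih => exact main hu hadj hr huy fun hv => ih hb hv hyb
  | pay hu hadj hr ih => exact main hu hadj hr huy fun hv => ih hb hv hyb

/-- A walk that descends passes through `S` at every depth in between. -/
theorem IsLayered.exists_mem_down (h : IsLayered G K F E S δ) (hA : A ⊆ E) (hb : b ∈ S)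
    (hr : Reach G A S q u b) {y : ℕ} (huy : y < δ u) (hyb : δ b ≤ y) :
    ∃ w ∈ A, w ∈ S ∧ δ w = y := by
  have main : ∀ {u v b : V} {q : ℕ}, u ∈ A → G.Adj u v → Reach G A S q v b → y < δ u →
      (y < δ v → ∃ w ∈ A, w ∈ S ∧ δ w = y) → ∃ w ∈ A, w ∈ S ∧ δ w = y := by
    intro u v b q hu hadj hr huy ih
    by_cases hvy : y < δ v
    · exact ih hvy
    have hs := h.step u (hA hu) v (hA hr.mem_left) hadj
    by_cases hvS : v ∈ S
    · exact ⟨v, hr.mem_left, hvS, by omega⟩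
    · have := hs.2 hvS; omega
  induction hr with
  | @nil q u hu hq => omega
  | free hu _ hadj hr ih => exact main hu hadj hr huy fun hv => ih hb hv hyb
  | pay hu hadj hr ih => exact main hu hadj hr huy fun hv => ih hb hv hyb

open Classical in
/-- The depth function that is `0` outside the sets of `𝓜` and one more than `δ (blk v)` on the set
`blk v` of `𝓜` containing `v`. -/
noncomputable def gluedDepth (𝓜 : Set (Set V)) (blk : V → Set V) (δ : Set V → V → ℕ) (v : V) : ℕ :=
  if v ∈ ⋃₀ 𝓜 then δ (blk v) v + 1 else 0

/-- A separator `T` together with the sets `S M` inside the sets `M` of `𝓜`. -/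
def gluedSet (T : Set V) (𝓜 : Set (Set V)) (blk : V → Set V) (S : Set V → Set V) : Set V :=
  {v | v ∈ T ∨ v ∈ ⋃₀ 𝓜 ∧ v ∈ S (blk v)}

/-- For a family of disjoint sets, a function assigns to each vertex the set containing it. -/
theorem exists_block (𝓜 : Set (Set V)) (h : ∀ M ∈ 𝓜, ∀ N ∈ 𝓜, ∀ x ∈ M, x ∈ N → M = N) :
    ∃ blk : V → Set V, ∀ M ∈ 𝓜, ∀ x ∈ M, blk x = M := by
  have : ∀ x : V, ∃ N : Set V, ∀ M ∈ 𝓜, x ∈ M → N = M := fun x => by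
    by_cases hx : x ∈ ⋃₀ 𝓜
    · obtain ⟨N, hN, hxN⟩ := hx
      exact ⟨N, fun M hM hxM => h N hN M hM x hxN hxM⟩
    · exact ⟨∅, fun M hM hxM => absurd ⟨M, hM, hxM⟩ hx⟩
  choose blk hblk using this
  exact ⟨blk, fun M hM x hx => hblk x M hM hx⟩

/-- Layered hitting sets of disjoint sets `M`, each entered only from a separator `T`, extend to the
whole set by taking `T` as the level of depth `0`. -/
theorem IsLayered.glue {𝓜 : Set (Set V)} {blk : V → Set V} {S : Set V → Set V}
    {δ : Set V → V → ℕ} (hEK : E ⊆ K) (hTE : T ⊆ E)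
    (hF : ∀ f ∈ F, ConnectedOn G f)
    (hblk : ∀ M ∈ 𝓜, ∀ x ∈ M, blk x = M) (hME : ∀ M ∈ 𝓜, M ⊆ E)
    (hT : ∀ M ∈ 𝓜, Disjoint M T)
    (hbd : ∀ M ∈ 𝓜, ∀ x ∈ K, x ∉ M → ∀ y ∈ M, G.Adj x y → x ∈ T)
    (hits : ∀ f ∈ F, f ⊆ E → (f ∩ T).Nonempty ∨ ∃ M ∈ 𝓜, (f ∩ M).Nonempty)
    (h : ∀ M ∈ 𝓜, IsLayered G K F M (S M) (δ M)) :
    IsLayered G K F E (gluedSet T 𝓜 blk S) (gluedDepth 𝓜 blk δ) := by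
  have hout : ∀ x ∈ T, x ∉ ⋃₀ 𝓜 := fun x hx ⟨M, hM, hxM⟩ =>
    Set.disjoint_left.1 (hT M hM) hxM hx
  refine ⟨?_, fun f hf hfE => ?_, fun u hu v hv hvE huv => ?_, fun u hu v hv huv => ?_⟩
  · rintro x (hx | ⟨⟨M, hM, hx⟩, -⟩)
    · exact hTE hx
    · exact hME M hM hx
  · by_cases hfT : (f ∩ T).Nonempty
    · obtain ⟨x, hxf, hxT⟩ := hfT
      exact ⟨x, hxf, .inl hxT⟩
    obtain ⟨M, hM, x, hxf, hxM⟩ := (hits f hf hfE).resolve_left hfT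
    have hfM : f ⊆ M := (hF f hf).subset_of_closed hxf hxM fun a _ haM b hb hab => by
      by_contra hbM
      exact hfT ⟨b, hb, hbd M hM b (hEK (hfE hb)) hbM a haM hab.symm⟩
    obtain ⟨y, hyf, hyS⟩ := (h M hM).hits f hf hfM
    exact ⟨y, hyf, .inr ⟨⟨M, hM, hfM hyf⟩, by rwa [hblk M hM y (hfM hyf)]⟩⟩
  · have : u ∉ ⋃₀ 𝓜 := fun ⟨M, hM, huM⟩ =>
      hvE (hTE (hbd M hM v hv (fun hvM => hvE (hME M hM hvM)) u huM huv.symm))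
    simp [gluedDepth, this]
  · by_cases huM : u ∈ ⋃₀ 𝓜
    · obtain ⟨M, hM, huM⟩ := huM
      have hu' : u ∈ ⋃₀ 𝓜 := ⟨M, hM, huM⟩
      by_cases hvM : v ∈ M
      · have hv' : v ∈ ⋃₀ 𝓜 := ⟨M, hM, hvM⟩
        have hs := (h M hM).step u huM v hvM huv
        simp only [gluedDepth, hu', hv', if_true, hblk M hM u huM, hblk M hM v hvM]
        refine ⟨by omega, fun hv => ?_⟩
        have : v ∉ S M := fun hvS => hv (.inr ⟨hv', by rwa [hblk M hM v hvM]⟩)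
        have := hs.2 this
        omega
      · have hvT := hbd M hM v (hEK hv) hvM u huM huv.symm
        have hb := (h M hM).base u huM v (hEK hv) hvM huv
        simp only [gluedDepth, hu', if_true, hblk M hM u huM, hb]
        exact ⟨by omega, fun hv => absurd (.inl hvT) hv⟩
    · simp [gluedDepth, huM]

/-- If every connected part of `K` can be separated, by at most `B` vertices, from the members of
`F` in the rest, then `K` has a layered hitting set all of whose levels have at most `B` vertices.
The set is a sequence of nested frontiers: only the vertices of each separator that are accessible
from the part already explored are kept, so that the explored part stays connected. -/
theorem exists_layered_of_ncard_le [Finite V] {B : ℕ} (hK : ConnectedOn G K)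
    (hF : ∀ f ∈ F, ConnectedOn G f)
    (hS : ∀ E ⊆ K, ConnectedOn G (K \ E) → ∃ S ⊆ E, S.ncard ≤ B ∧
      ∀ f ∈ attached G F (K \ E), f ⊆ E → (f ∩ S).Nonempty) :
    ∀ (m : ℕ), ∀ E ⊆ K, ConnectedOn G (K \ E) → E.ncard = m →
      ∃ S δ, IsLayered G K F E S δ ∧ ∀ i, {b | b ∈ S ∧ δ b = i}.ncard ≤ B := by
  intro m
  induction m using Nat.strong_induction_on with
  | _ m IH =>
  intro E hEK hR hm
  obtain ⟨S, hSE, hSB, hSF⟩ := hS E hEK hR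
  set A : Set V := {u | u ∈ E \ S ∧ Touches G (compOn G (E \ S) u) (K \ E)} with hA
  set T : Set V := {s | s ∈ S ∧ ∃ x ∈ (K \ E) ∪ A, G.Adj x s} with hT
  set E' : Set V := E \ (A ∪ T) with hE'
  have hE'E : E' ⊆ E := Set.sdiff_subset
  have hTE : T ⊆ E := fun x hx => hSE hx.1
  have hbd : ∀ x ∈ K, x ∉ E' → ∀ y ∈ E', G.Adj x y → x ∈ T := by
    intro x hx hxE' y hy hxy
    by_contra hxT
    have hxRA : x ∈ (K \ E) ∪ A := by
      by_cases hxE : x ∈ E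
      · by_contra hno
        exact hxE' ⟨hxE, fun h => h.elim (fun h => hno (.inr h)) hxT⟩
      · exact .inl ⟨hx, hxE⟩
    have hyS : y ∉ S := fun hyS => hy.2 (.inr ⟨hyS, x, hxRA, hxy⟩)
    have hyES : y ∈ E \ S := ⟨hy.1, hyS⟩
    refine hy.2 (.inl ⟨hyES, ?_⟩)
    rcases hxRA with hxR | hxA
    · exact ⟨y, mem_compOn_self hyES, x, hxR, hxy.symm⟩
    · have : y ∈ compOn G (E \ S) x := compOn_closed (mem_compOn_self hxA.1) hyES hxy
      rw [compOn_eq_of_mem this]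
      exact hxA.2
  have hR' : ConnectedOn G (K \ E') := by
    have hsub : K \ E ⊆ K \ E' := fun x hx => ⟨hx.1, fun h => hx.2 (hE'E h)⟩
    have hAl : ∀ x ∈ A, ∃ y ∈ K \ E, Linked G (K \ E') x y := by
      rintro x ⟨hx, z, hz, y, hy, hzy⟩
      have hcA : compOn G (E \ S) x ⊆ K \ E' := fun w hw =>
        ⟨hEK (compOn_subset hw).1, fun h => h.2 (.inl ⟨compOn_subset hw, by
          rw [compOn_eq_of_mem hw]; exact ⟨z, hz, y, hy, hzy⟩⟩)⟩
      refine ⟨y, hy, (((connectedOn_compOn hx).2 x (mem_compOn_self hx) z hz).mono hcA).trans ?_⟩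
      exact .of_adj (hcA hz) (hsub hy) hzy
    refine hR.of_linked hsub fun x hx => ?_
    by_cases hxE : x ∈ E
    · have : x ∈ A ∪ T := by
        by_contra h
        exact hx.2 ⟨hxE, h⟩
      rcases this with hxA | ⟨-, z, hz | hz, hzx⟩
      · exact hAl x hxA
      · exact ⟨z, hz, .of_adj hx (hsub hz) hzx.symm⟩
      · obtain ⟨y, hy, hl⟩ := hAl z hz
        exact ⟨y, hy, (Linked.of_adj hx hl.mem_left hzx.symm).trans hl⟩
    · exact ⟨x, ⟨hx.1, hxE⟩, .refl hx⟩
  have hfin : ∃ S' δ', IsLayered G K F E' S' δ' ∧ ∀ i, {b | b ∈ S' ∧ δ' b = i}.ncard ≤ B := by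
    by_cases hEe : E.Nonempty
    · refine IH _ ?_ E' (hE'E.trans hEK) hR' rfl
      rw [← hm]
      refine Set.ncard_lt_ncard (hE'E.ssubset_of_ne fun hEq => ?_) (Set.toFinite _)
      -- Some vertex of `E` next to `K \ E` lies in the frontier or in an explored component.
      obtain ⟨r, hr⟩ := hR.1
      have : K ⊆ K \ E := hK.subset_of_closed hr.1 hr fun x hx hxR y hy hxy => by
        refine ⟨hy, fun hyE => ?_⟩
        have hxT := hbd x hx (fun h => hxR.2 (hE'E h)) y (hEq ▸ hyE) hxy
        exact hxR.2 (hTE hxT)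
      obtain ⟨e, he⟩ := hEe
      exact (this (hEK he)).2 he
    · rw [Set.not_nonempty_iff_eq_empty] at hEe
      have hE'e : E' = ∅ := by rw [hE', hEe, Set.empty_sdiff]
      refine ⟨∅, fun _ => 0, ?_, by simp⟩
      rw [hE'e]
      refine ⟨le_rfl, fun f hf hfE => ?_, by simp, by simp⟩
      obtain ⟨x, hx⟩ := (hF f hf).1
      exact absurd (hfE hx) (by simp)
  obtain ⟨S', δ', hl, hB⟩ := hfin
  have hdT : Disjoint E' T := Set.disjoint_left.2 fun x hx hxT => hx.2 (.inr hxT)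
  have hg : IsLayered G K F E (gluedSet T {E'} (fun _ => E') (fun _ => S'))
      (gluedDepth {E'} (fun _ => E') (fun _ => δ')) := by
    refine .glue hEK hTE hF (by simp) (by simpa using hE'E) (by simpa using hdT)
      (by simpa using hbd) (fun f hf hfE => ?_) (by simpa using hl)
    by_contra! hno
    have hfA : f ⊆ A := fun x hx => by
      by_contra hxA
      have hxT : x ∉ T := fun hxT => (hno.1 ▸ ⟨hx, hxT⟩ : x ∈ (∅ : Set V))
      have hxE' : x ∈ E' := ⟨hfE hx, fun h => h.elim hxA hxT⟩
      exact (hno.2 E' rfl ▸ ⟨hx, hxE'⟩ : x ∈ (∅ : Set V))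
    obtain ⟨x, hx⟩ := (hF f hf).1
    have hxES := (hfA hx).1
    obtain ⟨y, hy, hyS⟩ := hSF (compOn G (E \ S) x)
      ⟨connectedOn_compOn hxES, ⟨f, hf, (hF f hf).subset_compOn
        (fun z hz => (hfA hz).1) hx⟩, (hfA hx).2⟩ (compOn_subset.trans Set.sdiff_subset)
    exact (compOn_subset hy).2 hyS
  refine ⟨_, _, hg, fun i => ?_⟩
  cases i with
  | zero =>
    refine (Set.ncard_le_ncard ?_ (Set.toFinite _)).trans hSB
    rintro b ⟨hb | ⟨hb, -⟩, hb0⟩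
    · exact hb.1
    · rw [gluedDepth, if_pos hb] at hb0
      exact absurd hb0 (by simp)
  | succ i =>
    refine (Set.ncard_le_ncard ?_ (Set.toFinite _)).trans (hB i)
    rintro b ⟨hb, hbi⟩
    by_cases hbE : b ∈ E'
    · simp only [gluedDepth, Set.sUnion_singleton, hbE, if_true, Nat.add_right_cancel_iff] at hbi
      refine ⟨?_, hbi⟩
      rcases hb with hb | ⟨-, hb⟩
      · exact absurd hb (Set.disjoint_left.1 hdT hbE)
      · exact hb
    · simp [gluedDepth, hbE] at hbi

end Layers

/-! ### Reachability in layered sets -/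

section LayerBounds

variable {V : Type u} {G : SimpleGraph V}

variable {K E S : Set V} {F : Set (Set V)} {δ : V → ℕ} {q B : ℕ}

/-- If every part `E` of `K` with connected complement has a set of reach bound `B` that meets all
members of `F` next to `K \ E`, then `K` has a layered hitting set each of whose levels contributes
at most `B` reachable vertices. The levels branch: the recursion continues in the maximal hulls of
the components still containing members of `F`. -/
theorem exists_layered_of_reachBounded [Finite V] (hK : ConnectedOn G K)
    (hF : ∀ f ∈ F, ConnectedOn G f)
    (hS : ∀ E ⊆ K, ConnectedOn G (K \ E) → ∃ S ⊆ E,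
      (∀ f ∈ attached G F (K \ E), f ⊆ E → (f ∩ S).Nonempty) ∧ ReachBounded G E S q B) :
    ∀ (m : ℕ), ∀ E ⊆ K, ConnectedOn G (K \ E) → E.ncard = m →
      ∃ S δ κ, IsLayered G K F E S δ ∧
        (∀ u i, {b | b ∈ reachSet G E S κ q u ∧ δ b = i}.ncard ≤ B) ∧
        ∀ u, ∀ b ∈ reachSet G E S κ q u, δ b ≤ δ u := by
  classical
  intro m
  induction m using Nat.strong_induction_on with
  | _ m IH =>
  intro E hEK hR hm
  obtain ⟨S, hSE, hSF, κ, hκ⟩ := hS E hEK hR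
  set 𝓑 : Set (Set V) := {C | (∃ u ∈ E \ S, C = compOn G (E \ S) u) ∧ ∃ f ∈ F, f ⊆ C} with h𝓑
  obtain ⟨𝓜, core, hdisj, h𝓜, hcov⟩ := exists_maximal_hulls (S := S) hK hEK hR 𝓑 (by
    rintro C ⟨⟨u, hu, rfl⟩, f, hf, hfC⟩
    refine ⟨⟨u, hu, rfl⟩, fun x hx y hy hxy => ?_⟩
    obtain ⟨z, hz, hzS⟩ := hSF (compOn G (E \ S) u)
      ⟨connectedOn_compOn hu, ⟨f, hf, hfC⟩, x, hx, y, hy, hxy⟩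
      (compOn_subset.trans Set.sdiff_subset)
    exact (compOn_subset hz).2 hzS)
  obtain ⟨blk, hblk⟩ := exists_block 𝓜 hdisj
  have hrec : ∀ M : Set V, ∃ S' δ' κ', M ∈ 𝓜 → IsLayered G K F M S' δ' ∧
      (∀ u i, {b | b ∈ reachSet G M S' κ' q u ∧ δ' b = i}.ncard ≤ B) ∧
      ∀ u, ∀ b ∈ reachSet G M S' κ' q u, δ' b ≤ δ' u := fun M => by
    by_cases hM : M ∈ 𝓜
    · obtain ⟨hME, hlt, hc, -⟩ := h𝓜 M hM
      obtain ⟨S', δ', κ', h⟩ := IH _ (hm ▸ hlt) M (hME.trans hEK) hc rfl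
      exact ⟨S', δ', κ', fun _ => h⟩
    · exact ⟨∅, fun _ => 0, fun _ => 0, fun h => absurd h hM⟩
  choose S' δ' κ' hrec using hrec
  set T := S \ ⋃₀ 𝓜 with hT
  have hTE : T ⊆ E := Set.sdiff_subset.trans hSE
  have hdT : ∀ M ∈ 𝓜, Disjoint M T := fun M hM =>
    Set.disjoint_left.2 fun x hx hxT => hxT.2 ⟨M, hM, hx⟩
  have hbd : ∀ M ∈ 𝓜, ∀ x ∈ K, x ∉ M → ∀ y ∈ M, G.Adj x y → x ∈ T :=
    fun M hM x hx hxM y hy hxy => by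
      have := (h𝓜 M hM).2.2.2.2.2.2 x hx hxM y hy hxy
      exact ⟨this.2.1, fun ⟨N, hN, hxN⟩ => this.2.2 N hN hxN⟩
  set Q := gluedSet T 𝓜 blk S'
  set δ := gluedDepth 𝓜 blk δ' with hδ
  have hg : IsLayered G K F E Q δ := by
    refine .glue hEK hTE hF hblk (fun M hM => (h𝓜 M hM).1) hdT hbd (fun f hf hfE => ?_)
      fun M hM => (hrec M hM).1
    by_cases hfS : (f ∩ S).Nonempty
    · obtain ⟨x, hxf, hxS⟩ := hfS
      by_cases hx : x ∈ ⋃₀ 𝓜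
      · obtain ⟨M, hM, hxM⟩ := hx
        exact .inr ⟨M, hM, x, hxf, hxM⟩
      · exact .inl ⟨x, hxf, hxS, hx⟩
    · obtain ⟨x, hx⟩ := (hF f hf).1
      have hfES : f ⊆ E \ S := fun y hy => ⟨hfE hy, fun hyS => hfS ⟨y, hy, hyS⟩⟩
      have hfC := (hF f hf).subset_compOn hfES hx
      obtain ⟨M, hM, hCM⟩ := hcov _ ⟨⟨x, hfES hx, rfl⟩, f, hf, hfC⟩
      exact .inr ⟨M, hM, x, hx, hCM (hfC hx)⟩
  -- Keys on `T` come before all other keys.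
  obtain ⟨N, hN⟩ : ∃ N, ∀ v, κ v < N := by
    obtain ⟨N, hN⟩ := (Set.finite_range κ).bddAbove
    exact ⟨N + 1, fun v => Nat.lt_succ_of_le (hN ⟨v, rfl⟩)⟩
  set κ₁ : V → ℕ := fun v => if v ∈ ⋃₀ 𝓜 then N + κ' (blk v) v else κ v with hκ₁
  have hκT : ∀ v ∈ T, κ₁ v = κ v := fun v hv => if_neg hv.2
  have hκM : ∀ M ∈ 𝓜, ∀ v ∈ M, κ₁ v = N + κ' M v := fun M hM v hv => by
    simp only [hκ₁]
    rw [if_pos ⟨M, hM, hv⟩, hblk M hM v hv]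
  have hδM : ∀ M ∈ 𝓜, ∀ v ∈ M, δ v = δ' M v + 1 := fun M hM v hv => by
    rw [hδ, gluedDepth, if_pos ⟨M, hM, hv⟩, hblk M hM v hv]
  have hδ0 : ∀ v, v ∉ ⋃₀ 𝓜 → δ v = 0 := fun v hv => if_neg hv
  have hQM : ∀ M ∈ 𝓜, ∀ v ∈ M, (v ∈ Q ↔ v ∈ S' M) := fun M hM v hv => by
    constructor
    · rintro (h | ⟨-, h⟩)
      · exact absurd ⟨M, hM, hv⟩ h.2
      · rwa [hblk M hM v hv] at h
    · exact fun h => .inr ⟨⟨M, hM, hv⟩, by rwa [hblk M hM v hv]⟩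
  -- A walk to a vertex of `Q` inside `M` avoids `T`, so it stays in `M`.
  have hloc : ∀ M ∈ 𝓜, ∀ u, ∀ b ∈ M, b ∈ reachSet G E Q κ₁ q u →
      u ∈ M ∧ b ∈ reachSet G M (S' M) (κ' M) q u := by
    rintro M hM u b hbM ⟨hb, hr⟩
    have hr' := hr.restrict (P := M) hbM fun x hx hxM y hy hxy => by
      by_contra hyM
      have hyT := hbd M hM y (hEK hy.1) hyM x hxM hxy.symm
      refine hy.2 ⟨.inl hyT, ?_⟩
      rw [hκT y hyT, hκM M hM b hbM]
      exact (hN y).trans_le (Nat.le_add_right _ _)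
    refine ⟨hr'.mem_left.2, (hQM M hM b hbM).1 hb, hr'.mono ?_ ?_ le_rfl⟩
    · rintro w ⟨⟨-, hw⟩, hwM⟩
      refine ⟨hwM, fun h => hw ⟨(hQM M hM w hwM).2 h.1, ?_⟩⟩
      rw [hκM M hM w hwM, hκM M hM b hbM]
      exact Nat.add_lt_add_left h.2 _
    · exact fun w hw => (hQM M hM w ((hrec M hM).1.subset hw)).2 hw
  refine ⟨Q, δ, κ₁, hg, fun u i => ?_, fun u b hb => ?_⟩
  · cases i with
    | zero =>
      obtain ⟨u', hu'⟩ := exists_reachSet_sdiff_subset (G := G) (E := E) (S := S) 𝓜 core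
        (fun M hM => (h𝓜 M hM).2.2.2.1) (fun M hM => (h𝓜 M hM).2.2.2.2.1)
        (fun M hM => (h𝓜 M hM).2.2.2.2.2.1)
        (fun M hM x hx => (h𝓜 M hM).2.2.2.2.2.2 x (hEK hx)) κ q u
      refine (Set.ncard_le_ncard ?_ (Set.toFinite _)).trans (hκ u')
      rintro b ⟨⟨hb, hr⟩, hb0⟩
      have hbM : b ∉ ⋃₀ 𝓜 := fun ⟨M, hM, h⟩ => by
        rw [hδM M hM b h] at hb0
        exact absurd hb0 (by simp)
      have hbT : b ∈ T := hb.resolve_right fun h => hbM h.1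
      refine hu' ⟨hbT, hr.mono ?_ (fun w hw => .inl hw) le_rfl⟩
      refine fun w hw => ⟨hw.1, fun h => hw.2 ⟨.inl h.1, ?_⟩⟩
      rw [hκT w h.1, hκT b hbT]
      exact h.2
    | succ i =>
      by_cases hu : u ∈ ⋃₀ 𝓜
      · obtain ⟨M, hM, huM⟩ := hu
        refine (Set.ncard_le_ncard ?_ (Set.toFinite _)).trans ((hrec M hM).2.1 u i)
        rintro b ⟨hb, hbi⟩
        by_cases hbM : b ∈ ⋃₀ 𝓜
        · obtain ⟨M', hM', hbM'⟩ := hbM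
          obtain ⟨huM', hb'⟩ := hloc M' hM' u b hbM' hb
          obtain rfl := hdisj M hM M' hM' u huM huM'
          rw [hδM M hM b hbM'] at hbi
          exact ⟨hb', by omega⟩
        · rw [hδ0 b hbM] at hbi
          exact absurd hbi (by simp)
      · convert Nat.zero_le B
        rw [Set.ncard_eq_zero (Set.toFinite _)]
        refine Set.eq_empty_of_forall_notMem ?_
        rintro b ⟨hb, hbi⟩
        by_cases hbM : b ∈ ⋃₀ 𝓜
        · obtain ⟨M', hM', hbM'⟩ := hbM
          exact hu ⟨M', hM', (hloc M' hM' u b hbM' hb).1⟩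
        · rw [hδ0 b hbM] at hbi
          exact absurd hbi (by simp)
  · by_cases hbM : b ∈ ⋃₀ 𝓜
    · obtain ⟨M, hM, hbM⟩ := hbM
      obtain ⟨huM, hb'⟩ := hloc M hM u b hbM hb
      rw [hδM M hM b hbM, hδM M hM u huM]
      exact Nat.succ_le_succ ((hrec M hM).2.2 u b hb')
    · rw [hδ0 b hbM]
      exact Nat.zero_le _

theorem ncard_le_mul_of_fibers [Finite V] {α : Type*} (S : Set V) (φ : V → α) (I : Finset α)
    (hI : ∀ b ∈ S, φ b ∈ I) (hB : ∀ i ∈ I, {b | b ∈ S ∧ φ b = i}.ncard ≤ B) :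
    S.ncard ≤ I.card * B := by
  classical
  have hfin := Set.toFinite S
  rw [Set.ncard_eq_toFinset_card S hfin, mul_comm]
  refine Finset.card_le_mul_card_image_of_maps_to (f := φ) (by simpa using hI) B fun i hi => ?_
  rw [← Set.ncard_coe_finset]
  refine le_trans (le_of_eq (congrArg _ ?_)) (hB i hi)
  ext b
  simp

/-- Only the `q + 1` levels just above a vertex are within reach of it. -/
theorem IsLayered.reachBounded_of_levels [Finite V] {κ : V → ℕ} (h : IsLayered G K F E S δ)
    (hB : ∀ u i, {b | b ∈ reachSet G E S κ q u ∧ δ b = i}.ncard ≤ B)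
    (hle : ∀ u, ∀ b ∈ reachSet G E S κ q u, δ b ≤ δ u) :
    ReachBounded G E S q ((q + 1) * B) := by
  refine ⟨κ, fun u => ?_⟩
  have := ncard_le_mul_of_fibers (reachSet G E S κ q u) δ (Finset.Icc (δ u - q) (δ u))
    (fun b hb => by
      have := hle u b hb
      have := (h.depth_le_add Set.sdiff_subset hb.1 hb.2).1
      simp only [Finset.mem_Icc]
      omega) (fun i _ => hB u i)
  refine this.trans (Nat.mul_le_mul_right _ ?_)
  simp only [Nat.card_Icc]
  omega

/-! ### Dyadic keys -/

/-- The exponent of the largest power of two, up to `2 ^ M`, that divides `x`. -/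
def cappedVal (M x : ℕ) : ℕ := Nat.findGreatest (fun j => 2 ^ j ∣ x) M

theorem cappedVal_le (M x : ℕ) : cappedVal M x ≤ M := Nat.findGreatest_le _

theorem two_pow_cappedVal_dvd (M x : ℕ) : 2 ^ cappedVal M x ∣ x :=
  Nat.findGreatest_spec (P := fun j => 2 ^ j ∣ x) (Nat.zero_le M) (by simp)

theorem le_cappedVal {M x j : ℕ} (hj : j ≤ M) (h : 2 ^ j ∣ x) : j ≤ cappedVal M x :=
  Nat.le_findGreatest hj h

/-- Between two numbers of equal valuation that are less than `2 ^ M` apart there is a number of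
larger valuation. -/
theorem exists_between_cappedVal {M x x' : ℕ} (hlt : x < x') (hM : x' < x + 2 ^ M)
    (h : cappedVal M x = cappedVal M x') :
    ∃ z, x < z ∧ z < x' ∧ cappedVal M x < cappedVal M z := by
  obtain ⟨a, ha⟩ := two_pow_cappedVal_dvd M x
  obtain ⟨a', ha'⟩ := two_pow_cappedVal_dvd M x'
  rw [← h] at ha'
  set j := cappedVal M x with hj
  have hpos : 0 < 2 ^ j := Nat.pow_pos (by norm_num)
  have haa' : a < a' := by
    by_contra hle
    have : 2 ^ j * a' ≤ 2 ^ j * a := Nat.mul_le_mul_left _ (by omega)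
    omega
  have hjM : j < M := by
    refine lt_of_le_of_ne (cappedVal_le M x) fun hjM => ?_
    have : 2 ^ j * (a + 1) ≤ 2 ^ j * a' := Nat.mul_le_mul_left _ haa'
    rw [Nat.mul_add, Nat.mul_one, hjM] at this
    rw [hjM] at ha ha'
    omega
  -- Both cofactors are odd, so the cofactor after the first one is even and below the second.
  have hodd : ∀ {y c : ℕ}, y = 2 ^ j * c → cappedVal M y = j → c % 2 = 1 := by
    intro y c hy hv
    by_contra hc
    have : j + 1 ≤ cappedVal M y := le_cappedVal hjM (by
      rw [hy, pow_succ]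
      exact Nat.mul_dvd_mul_left _ (by omega))
    omega
  have h1 := hodd ha hj.symm
  have h2 := hodd ha' h.symm
  refine ⟨2 ^ j * (a + 1), ?_, ?_, ?_⟩
  · rw [ha]; exact Nat.mul_lt_mul_of_pos_left (Nat.lt_succ_self _) hpos
  · rw [ha']; exact Nat.mul_lt_mul_of_pos_left (by omega) hpos
  · refine le_cappedVal hjM ?_
    rw [pow_succ]
    exact Nat.mul_dvd_mul_left _ (by omega)

/-- Levels of at most `B` vertices, with smaller keys for levels whose index is divisible by a
higher power of two: on each side of a vertex only one level of each valuation is within reach. -/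
theorem IsLayered.reachBounded_of_dyadic [Finite V] {M : ℕ} (h : IsLayered G K F E S δ)
    (hB : ∀ i, {b | b ∈ S ∧ δ b = i}.ncard ≤ B) (hM : q < 2 ^ M) :
    ReachBounded G E S q (2 * (M + 1) * B) := by
  classical
  refine ⟨fun b => M - cappedVal M (δ b + 1), fun u => ?_⟩
  set κ : V → ℕ := fun b => M - cappedVal M (δ b + 1) with hκ
  have hle : ∀ b ∈ reachSet G E S κ q u, δ u ≤ δ b + q ∧ δ b < δ u + q := fun b hb =>
    ⟨(h.depth_le_add Set.sdiff_subset hb.1 hb.2).1, h.depth_lt_add Set.sdiff_subset hb.1 hb.2⟩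
  have hpass : ∀ b ∈ reachSet G E S κ q u, ∀ y,
      (δ u ≤ y ∧ y ≤ δ b ∨ y < δ u ∧ δ b ≤ y) →
      cappedVal M (y + 1) ≤ cappedVal M (δ b + 1) := by
    intro b hb y hy
    obtain ⟨w, hwA, hwS, rfl⟩ : ∃ w ∈ E \ {w | w ∈ S ∧ κ w < κ b}, w ∈ S ∧ δ w = y := by
      rcases hy with hy | hy
      · exact h.exists_mem_up Set.sdiff_subset hb.1 hb.2 hy.1 hy.2
      · exact h.exists_mem_down Set.sdiff_subset hb.1 hb.2 hy.1 hy.2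
    by_contra hlt
    refine hwA.2 ⟨hwS, ?_⟩
    have := cappedVal_le M (δ w + 1)
    simp only [hκ]
    omega
  have hinj : ∀ b ∈ reachSet G E S κ q u, ∀ b' ∈ reachSet G E S κ q u,
      (decide (δ u ≤ δ b), cappedVal M (δ b + 1)) =
        (decide (δ u ≤ δ b'), cappedVal M (δ b' + 1)) → ¬ δ b < δ b' := by
    intro b hb b' hb' heq hlt
    simp only [Prod.mk.injEq, decide_eq_decide] at heq
    have h1 := hle b hb
    have h2 := hle b' hb'
    obtain ⟨z, hz1, hz2, hz⟩ := exists_between_cappedVal (M := M) (x := δ b + 1) (x' := δ b' + 1)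
      (by omega) (by omega) heq.2
    obtain ⟨y, rfl⟩ : ∃ y, z = y + 1 := ⟨z - 1, by omega⟩
    by_cases hu : δ u ≤ δ b
    · have := hpass b' hb' y (.inl (by omega))
      omega
    · have := hpass b hb y (.inr (by omega))
      omega
  have := ncard_le_mul_of_fibers (B := B) (reachSet G E S κ q u)
    (fun b => (decide (δ u ≤ δ b), cappedVal M (δ b + 1)))
    ((Finset.univ : Finset Bool) ×ˢ Finset.range (M + 1))
    (fun b _ => by
      simp only [Finset.mem_product, Finset.mem_univ, Finset.mem_range, true_and]
      exact Nat.lt_succ_of_le (cappedVal_le _ _)) fun i _ => by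
        by_cases hne : {b | b ∈ reachSet G E S κ q u ∧
            (decide (δ u ≤ δ b), cappedVal M (δ b + 1)) = i}.Nonempty
        · obtain ⟨b₀, hb₀, rfl⟩ := hne
          refine (Set.ncard_le_ncard ?_ (Set.toFinite _)).trans (hB (δ b₀))
          rintro b ⟨hb, hbi⟩
          have := hinj b hb b₀ hb₀ hbi
          have := hinj b₀ hb₀ b hb hbi.symm
          exact ⟨hb.1, by omega⟩
        · rw [Set.not_nonempty_iff_eq_empty] at hne
          rw [hne]
          simp
  simpa using this

end LayerBounds

/-! ### Packing and covering connected sets -/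

/-- Every family of connected sets has `k` pairwise disjoint members or is met by a set of at most
`k * n` vertices. -/
def PackingBound {V : Type u} (G : SimpleGraph V) (n : ℕ) : Prop :=
  ∀ 𝓕 : Set (Set V), (∀ X ∈ 𝓕, ConnectedOn G X) → ∀ k : ℕ,
    (∃ f : Fin k → Set V, (∀ i, f i ∈ 𝓕) ∧ ∀ i j, i ≠ j → Disjoint (f i) (f j)) ∨
      ∃ Z : Set V, Z.ncard ≤ k * n ∧ ∀ X ∈ 𝓕, (X ∩ Z).Nonempty

section Tree

variable {N : Type v} {T : SimpleGraph N} {ρ : N}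

theorem eq_of_mem_support_of_length_le_dist {q x : N} (p : T.Walk ρ q) (hx : x ∈ p.support)
    (h : p.length ≤ T.dist ρ x) : x = q := by
  classical
  have h1 := T.dist_le (p.takeUntil x hx)
  have h2 := congrArg SimpleGraph.Walk.length (p.take_spec hx)
  rw [SimpleGraph.Walk.length_append] at h2
  exact SimpleGraph.Walk.eq_of_length_eq_zero (p := p.dropUntil x hx) (by omega)

/-- The path from the root to a vertex of a connected set `Q` enters `Q` at its top vertex. -/
theorem exists_path_through_top (hT : T.Connected) {Q : Set N} (hQ : ConnectedOn T Q) {q y : N}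
    (hq : q ∈ Q) (hmin : ∀ x ∈ Q, T.dist ρ q ≤ T.dist ρ x) (hy : y ∈ Q) :
    ∃ (p₀ : T.Walk ρ q) (p₁ : T.Walk q y), p₀.length = T.dist ρ q ∧
      (∀ x ∈ p₁.support, x ∈ Q) ∧ (p₀.append p₁).IsPath := by
  classical
  obtain ⟨p₀, hp₀, hlen⟩ := hT.exists_path_of_dist ρ q
  obtain ⟨p, hp⟩ := hQ.2 q hq y hy
  refine ⟨p₀, p.bypass, hlen, fun x hx => hp x (p.support_bypass_subset_support hx), ?_⟩
  rw [SimpleGraph.Walk.isPath_def, SimpleGraph.Walk.support_append, List.nodup_append']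
  have hp₁ := p.bypass_isPath
  rw [SimpleGraph.Walk.isPath_def] at hp₀ hp₁
  refine ⟨hp₀, hp₁.tail, fun x hx hx' => ?_⟩
  have hxQ : x ∈ Q := hp x (p.support_bypass_subset_support (List.mem_of_mem_tail hx'))
  obtain rfl := eq_of_mem_support_of_length_le_dist p₀ hx (hlen ▸ hmin x hxQ)
  rw [← SimpleGraph.Walk.cons_tail_support, List.nodup_cons] at hp₁
  exact hp₁.1 hx'

/-- Of two intersecting connected sets of a rooted tree, one whose top vertex is no higher than that
of the other has its top vertex in the other. -/
theorem top_mem_of_dist_le (hT : T.IsTree) {P Q : Set N} (hP : ConnectedOn T P)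
    (hQ : ConnectedOn T Q) {p q y : N} (hp : p ∈ P) (hq : q ∈ Q)
    (hpmin : ∀ x ∈ P, T.dist ρ p ≤ T.dist ρ x) (hqmin : ∀ x ∈ Q, T.dist ρ q ≤ T.dist ρ x)
    (hyP : y ∈ P) (hyQ : y ∈ Q) (h : T.dist ρ q ≤ T.dist ρ p) : p ∈ Q := by
  obtain ⟨p₀, p₁, -, -, hpp⟩ := exists_path_through_top hT.connected hP hp hpmin hyP
  obtain ⟨q₀, q₁, hlen, hq₁, hqp⟩ := exists_path_through_top hT.connected hQ hq hqmin hyQ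
  have heq : p₀.append p₁ = q₀.append q₁ := congrArg Subtype.val
    ((hT.isAcyclic.subsingleton_path ρ y).elim ⟨_, hpp⟩ ⟨_, hqp⟩)
  have hmem : p ∈ (q₀.append q₁).support := by
    rw [← heq, SimpleGraph.Walk.mem_support_append_iff]
    exact .inl (SimpleGraph.Walk.end_mem_support _)
  rw [SimpleGraph.Walk.mem_support_append_iff] at hmem
  rcases hmem with hmem | hmem
  · rw [eq_of_mem_support_of_length_le_dist q₀ hmem (hlen ▸ h)]
    exact hq
  · exact hq₁ p hmem

theorem connectedOn_trace {V : Type u} {G : SimpleGraph V} {W : N → Set V}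
    (h : IsTreeDecomposition G T W) {X : Set V} (hX : ConnectedOn G X) :
    ConnectedOn T {x | (W x ∩ X).Nonempty} := by
  have hbag : ∀ a, ConnectedOn T {x | a ∈ W x} := fun a => connectedOn_iff.2 (h.connected a)
  have hsub : ∀ a ∈ X, {x | a ∈ W x} ⊆ {x | (W x ∩ X).Nonempty} := fun a ha x hx => ⟨a, hx, ha⟩
  refine ⟨?_, ?_⟩
  · obtain ⟨a, ha⟩ := hX.1
    exact (hbag a).1.mono (hsub a ha)
  have key : ∀ (a b : V) (p : G.Walk a b), (∀ c ∈ p.support, c ∈ X) →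
      ∀ x y, a ∈ W x → b ∈ W y → Linked T {x | (W x ∩ X).Nonempty} x y := by
    intro a b p
    induction p with
    | nil => exact fun hp x y hx hy => ((hbag _).2 x hx y hy).mono (hsub _ (hp _ (by simp)))
    | cons hadj p ih =>
      intro hp x y hx hy
      obtain ⟨z, hz, hz'⟩ := h.edge _ _ hadj
      exact (((hbag _).2 x hx z hz).mono (hsub _ (hp _ (by simp)))).trans
        (ih (fun c hc => hp c (by simp [hc])) z y hz' hy)
  rintro x ⟨a, hax, haX⟩ y ⟨b, hby, hbX⟩
  obtain ⟨p, hp⟩ := hX.2 a haX b hbX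
  exact key a b p hp x y hax hby

/-- A tree decomposition with bags of at most `n` vertices yields the packing bound `n`: the bag at
the top vertex of a member of largest top depth meets all members that are not disjoint from it. -/
theorem IsTreeDecomposition.packingBound [Finite N] {V : Type u} [Finite V] {G : SimpleGraph V}
    {W : N → Set V} {n : ℕ} (h : IsTreeDecomposition G T W) (hn : ∀ x, (W x).ncard ≤ n) :
    PackingBound G n := by
  obtain ⟨ρ⟩ := h.isTree.connected.nonempty
  have htop : ∀ X : Set V, ∃ x : N, ConnectedOn G X → (W x ∩ X).Nonempty ∧
      ∀ y, (W y ∩ X).Nonempty → T.dist ρ x ≤ T.dist ρ y := fun X => by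
    by_cases hX : ConnectedOn G X
    · obtain ⟨x, hx, hmin⟩ := Set.exists_min_image {x | (W x ∩ X).Nonempty} (T.dist ρ)
        (Set.toFinite _) (connectedOn_trace h hX).1
      exact ⟨x, fun _ => ⟨hx, hmin⟩⟩
    · exact ⟨ρ, fun h => absurd h hX⟩
  choose top htop using htop
  intro 𝓕 h𝓕 k
  induction k generalizing 𝓕 with
  | zero => exact .inl ⟨fun i => i.elim0, fun i => i.elim0, fun i => i.elim0⟩
  | succ k ih =>
    by_cases hne : 𝓕.Nonempty
    · obtain ⟨X, hX, hmax⟩ := Set.exists_max_image 𝓕 (fun X => T.dist ρ (top X)) (Set.toFinite _) hne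
      have hdisj : ∀ Y ∈ 𝓕, ¬ (Y ∩ W (top X)).Nonempty → Disjoint X Y := by
        refine fun Y hY hYX => Set.disjoint_left.2 fun a haX haY => hYX ?_
        obtain ⟨⟨y, hy⟩⟩ := (h.connected a).nonempty
        obtain ⟨b, hb, hbY⟩ := top_mem_of_dist_le h.isTree (connectedOn_trace h (h𝓕 X hX))
          (connectedOn_trace h (h𝓕 Y hY)) (htop X (h𝓕 X hX)).1 (htop Y (h𝓕 Y hY)).1
          (htop X (h𝓕 X hX)).2 (htop Y (h𝓕 Y hY)).2 (y := y) ⟨a, hy, haX⟩ ⟨a, hy, haY⟩ (hmax Y hY)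
        exact ⟨b, hbY, hb⟩
      rcases ih {Y | Y ∈ 𝓕 ∧ ¬ (Y ∩ W (top X)).Nonempty} (fun Y hY => h𝓕 Y hY.1) with
        ⟨f, hf, hfd⟩ | ⟨Z, hZ, hZF⟩
      · refine .inl ⟨Fin.cons X f, fun i => ?_, fun i j => ?_⟩
        · refine Fin.cases hX (fun i => (hf i).1) i
        · refine Fin.cases ?_ (fun i => ?_) i <;> refine Fin.cases ?_ (fun j => ?_) j
          · exact fun h => absurd rfl h
          · exact fun _ => hdisj _ (hf j).1 (hf j).2
          · exact fun _ => (hdisj _ (hf i).1 (hf i).2).symm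
          · exact fun h => hfd i j fun h' => h (h' ▸ rfl)
      · refine .inr ⟨W (top X) ∪ Z, ?_, fun Y hY => ?_⟩
        · refine (Set.ncard_union_le _ _).trans ?_
          have := hn (top X)
          rw [Nat.add_mul, Nat.one_mul]
          omega
        · by_cases hYX : (Y ∩ W (top X)).Nonempty
          · exact hYX.mono (Set.inter_subset_inter_right _ Set.subset_union_left)
          · exact (hZF Y ⟨hY, hYX⟩).mono (Set.inter_subset_inter_right _ Set.subset_union_right)
    · exact .inr ⟨∅, by simp, fun X hX => absurd ⟨X, hX⟩ hne⟩

end Tree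

/-! ### Rich models of the universal graph of given treedepth -/

section Rich

variable {V : Type u} {G : SimpleGraph V}

/-- `K` contains a connected set `R` that contains a member of `F` and whose complement in `K`
satisfies `P` for the connected sets attached to `R`. -/
def HasCone (G : SimpleGraph V) (P : Set (Set V) → Set V → Prop) (F : Set (Set V))
    (K : Set V) : Prop :=
  ∃ R ⊆ K, ConnectedOn G R ∧ (∃ f ∈ F, f ⊆ R) ∧ P (attached G F R) (K \ R)

/-- `G[A]` has a model, each branch set of which contains a member of `F`, of the closure of the
`k`-ary forest of height `t` with `k` roots. Each tree of the forest lives in a connected set of its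
own; a branch set below a root is required to contain a set attached to the branch set of the
root. -/
def HasRichModel (G : SimpleGraph V) (k : ℕ) : ℕ → Set (Set V) → Set V → Prop
  | 0, _, _ => True
  | t + 1, F, A => ∃ K : Fin k → Set V, (∀ i j, i ≠ j → Disjoint (K i) (K j)) ∧
      ∀ i, K i ⊆ A ∧ ConnectedOn G (K i) ∧ HasCone G (HasRichModel G k t) F (K i)

variable {F F' : Set (Set V)} {A A' K R : Set V} {k t : ℕ}

theorem attached_mono (hF : F ⊆ F') : attached G F R ⊆ attached G F' R :=
  fun _ ⟨h1, ⟨g, hg, hgf⟩, h3⟩ => ⟨h1, ⟨g, hF hg, hgf⟩, h3⟩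

theorem HasRichModel.mono (h : HasRichModel G k t F A) (hF : F ⊆ F') (hA : A ⊆ A') :
    HasRichModel G k t F' A' := by
  induction t generalizing F F' A A' with
  | zero => trivial
  | succ t ih =>
    obtain ⟨K, hd, hK⟩ := h
    refine ⟨K, hd, fun i => ?_⟩
    obtain ⟨h1, h2, R, hRK, hR, ⟨f, hf, hfR⟩, hrich⟩ := hK i
    exact ⟨h1.trans hA, h2, R, hRK, hR, ⟨f, hF hf, hfR⟩, ih hrich (attached_mono hF) le_rfl⟩

theorem HasRichModel.of_succ (h : HasRichModel G (k + 1) t F A) : HasRichModel G k t F A := by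
  induction t generalizing F A with
  | zero => trivial
  | succ t ih =>
    obtain ⟨K, hd, hK⟩ := h
    refine ⟨fun i => K i.castSucc, fun i j hij => hd _ _ fun h => hij (Fin.castSucc_injective _ h),
      fun i => ?_⟩
    obtain ⟨h1, h2, R, hRK, hR, hf, hrich⟩ := hK i.castSucc
    exact ⟨h1, h2, R, hRK, hR, hf, ih hrich⟩

/-- A set next to which there is a rich model with `k + 1` roots is the apex of a cone: one of the
trees of the model is given up to provide the apex with a member of `F`. -/
theorem hasCone_of_hasRichModel_attached (hR : ConnectedOn G R) (hRK : R ⊆ K)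
    (h : HasRichModel G (k + 1) (t + 1) (attached G F R) (K \ R)) :
    HasCone G (HasRichModel G k (t + 1)) F K := by
  obtain ⟨L, hd, hL⟩ := h
  obtain ⟨hlK, -, Q, hQL, -, ⟨f, ⟨hfc, ⟨g, hg, hgf⟩, x, hx, y, hy, hxy⟩, hfQ⟩, -⟩ := hL (Fin.last k)
  have hfL : f ⊆ L (Fin.last k) := hfQ.trans hQL
  refine ⟨R ∪ f, Set.union_subset hRK (hfL.trans (hlK.trans Set.sdiff_subset)),
    hR.union hfc hy hx hxy.symm, ⟨g, hg, hgf.trans Set.subset_union_right⟩,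
    fun i => L i.castSucc, fun i j hij => hd _ _ fun h => hij (Fin.castSucc_injective _ h),
    fun i => ?_⟩
  obtain ⟨h1, h2, R', hR'L, hR', ⟨f', hf', hf'R⟩, hrich⟩ := hL i.castSucc
  have hsub : attached G F R ⊆ attached G F (R ∪ f) :=
    fun _ ⟨h1, h2, x, hx, y, hy, hxy⟩ => ⟨h1, h2, x, hx, y, .inl hy, hxy⟩
  refine ⟨fun z hz => ⟨(h1 hz).1, ?_⟩, h2, R', hR'L, hR', ⟨f', hsub hf', hf'R⟩,
    hrich.of_succ.mono (attached_mono hsub) le_rfl⟩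
  rintro (hzR | hzf)
  · exact (h1 hz).2 hzR
  · exact Set.disjoint_left.1 (hd i.castSucc (Fin.last k) (Fin.castSucc_lt_last i).ne) hz (hfL hzf)

theorem exists_hitting_of_not_hasRichModel [Finite V] {n : ℕ} (hG : PackingBound G n)
    (h : ¬ HasRichModel G k (t + 1) F A) :
    ∃ Z ⊆ A, Z.ncard ≤ k * n ∧ ∀ K ⊆ A \ Z, ConnectedOn G K →
      ¬ HasCone G (HasRichModel G k t) F K := by
  rcases hG {K | K ⊆ A ∧ ConnectedOn G K ∧ HasCone G (HasRichModel G k t) F K}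
    (fun K hK => hK.2.1) k with ⟨f, hf, hd⟩ | ⟨Z, hZ, hZF⟩
  · exact absurd ⟨f, hd, hf⟩ h
  · refine ⟨Z ∩ A, Set.inter_subset_right,
      (Set.ncard_le_ncard Set.inter_subset_left (Set.toFinite _)).trans hZ, fun K hK hKc hcone => ?_⟩
    obtain ⟨x, hxK, hxZ⟩ := hZF K ⟨hK.trans Set.sdiff_subset, hKc, hcone⟩
    exact (hK hxK).2 ⟨hxZ, (hK hxK).1⟩

end Rich

section Treedepth

variable {U : Type w} {X : SimpleGraph U}

theorem componentSet_mk {s : Set U} {x : U} (hx : x ∈ s) :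
    componentSet X s ((X.induce s).connectedComponentMk ⟨x, hx⟩) = compOn X s x := by
  ext w
  simp only [componentSet, Set.mem_image, SimpleGraph.ConnectedComponent.mem_supp_iff,
    SimpleGraph.ConnectedComponent.eq, Subtype.exists, exists_and_right, exists_eq_right]
  constructor
  · rintro ⟨hw, h⟩
    exact ((linked_iff_reachable hw hx).2 h).symm
  · intro h
    exact ⟨h.mem_right, (linked_iff_reachable h.mem_right hx).1 h.symm⟩

variable [Finite U]

theorem exists_treedepthOn_sdiff_of_connected {s : Set U} (hs : (X.induce s).Connected) :
    ∃ v ∈ s, treedepthOn X (s \ {v}) + 1 = treedepthOn X s := by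
  have hne : Nonempty s := hs.nonempty
  have hs' : s ≠ ∅ := by
    rintro rfl
    exact hne.elim fun x => x.2
  rw [treedepthOn.eq_def X s, dif_neg hs', dif_pos hs]
  obtain ⟨v, hv⟩ := Nat.sInf_mem (Set.range_nonempty fun v : s => treedepthOn X (s \ {v.1}))
  exact ⟨v, v.2, by rw [iInf, ← hv]⟩

/-- Each component has a vertex whose deletion brings its treedepth below that of the graph. -/
theorem exists_treedepthOn_compOn_sdiff {s : Set U} {x : U} (hx : x ∈ s) :
    ∃ v ∈ compOn X s x, treedepthOn X (compOn X s x \ {v}) + 1 ≤ treedepthOn X s := by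
  have hc := connectedOn_iff.1 (connectedOn_compOn (G := X) hx)
  obtain ⟨v, hv, hvt⟩ := exists_treedepthOn_sdiff_of_connected hc
  refine ⟨v, hv, hvt.le.trans ?_⟩
  by_cases hs : (X.induce s).Connected
  · rw [compOn_subset.antisymm ((connectedOn_iff.2 hs).subset_compOn le_rfl hx)]
  · have hs' : s ≠ ∅ := Set.nonempty_iff_ne_empty.1 ⟨x, hx⟩
    rw [treedepthOn.eq_def X s, dif_neg hs', dif_neg hs, ← componentSet_mk hx]
    exact le_ciSup (f := fun C : (X.induce s).ConnectedComponent =>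
      treedepthOn X (componentSet X s C)) (Set.toFinite _).bddAbove _

variable {V : Type u} {G : SimpleGraph V} {k : ℕ}

/-- A rich model of the universal graph of treedepth `t` contains a rich model of every graph on at
most `k` vertices of treedepth at most `t`. -/
theorem HasRichModel.exists_model {t : ℕ} {F : Set (Set V)} {A : Set V} {s : Set U}
    (h : HasRichModel G k t F A) (ht : treedepthOn X s ≤ t) (hk : s.ncard ≤ k) :
    ∃ B : U → Set V, (∀ x ∈ s, B x ⊆ A ∧ ConnectedOn G (B x) ∧ ∃ f ∈ F, f ⊆ B x) ∧
      (∀ x ∈ s, ∀ y ∈ s, x ≠ y → Disjoint (B x) (B y)) ∧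
      ∀ x ∈ s, ∀ y ∈ s, X.Adj x y → Touches G (B x) (B y) := by
  classical
  induction t generalizing F A s with
  | zero =>
    have : s = ∅ := Set.eq_empty_of_forall_notMem fun x hx => by
      obtain ⟨v, -, hv⟩ := exists_treedepthOn_compOn_sdiff (X := X) hx
      omega
    subst this
    exact ⟨fun _ => ∅, by simp, by simp, by simp⟩
  | succ t ih =>
    rcases s.eq_empty_or_nonempty with rfl | ⟨x₀, hx₀⟩
    · exact ⟨fun _ => ∅, by simp, by simp, by simp⟩
    obtain ⟨K, hd, hK⟩ := h
    choose hKA hKc R hRK hRc hRF hrich using hK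
    -- Components of `X[s]` are sent injectively to the sets `K i`.
    obtain ⟨idx, hidx⟩ : ∃ idx : Set U → Fin k, ∀ x ∈ s, ∀ y ∈ s,
        idx (compOn X s x) = idx (compOn X s y) → compOn X s x = compOn X s y := by
      have hcard : Nat.card s ≤ Nat.card (Fin k) := by simpa using hk
      obtain ⟨e⟩ : Nonempty (s ↪ Fin k) := by
        have := Fintype.ofFinite s
        rw [Nat.card_eq_fintype_card, Nat.card_eq_fintype_card] at hcard
        exact Function.Embedding.nonempty_of_card_le hcard
      have hrep : ∀ C : Set U, ∃ z : s, (∃ x ∈ s, C = compOn X s x) → (z : U) ∈ C := fun C => by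
        by_cases hC : ∃ x ∈ s, C = compOn X s x
        · obtain ⟨x, hx, rfl⟩ := hC
          exact ⟨⟨x, hx⟩, fun _ => mem_compOn_self hx⟩
        · exact ⟨⟨x₀, hx₀⟩, fun h => absurd h hC⟩
      choose rep hrep using hrep
      refine ⟨fun C => e (rep C), fun x hx y hy hxy => ?_⟩
      have h1 := hrep _ ⟨x, hx, rfl⟩
      have h2 := hrep _ ⟨y, hy, rfl⟩
      rw [e.injective hxy] at h1
      rw [← compOn_eq_of_mem h1, compOn_eq_of_mem h2]
    have happex : ∀ C : Set U, ∃ v, ∀ x ∈ s, C = compOn X s x →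
        v ∈ C ∧ treedepthOn X (C \ {v}) ≤ t := fun C => by
      by_cases hC : ∃ x ∈ s, C = compOn X s x
      · obtain ⟨x, hx, rfl⟩ := hC
        obtain ⟨v, hv, hvt⟩ := exists_treedepthOn_compOn_sdiff (X := X) hx
        exact ⟨v, fun _ _ _ => ⟨hv, by omega⟩⟩
      · exact ⟨x₀, fun x hx h => absurd ⟨x, hx, h⟩ hC⟩
    choose apex happex using happex
    have hmodel : ∀ C : Set U, ∃ B : U → Set V, ∀ x ∈ s, C = compOn X s x →
        (∀ y ∈ C \ {apex C}, B y ⊆ K (idx C) \ R (idx C) ∧ ConnectedOn G (B y) ∧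
          ∃ f ∈ attached G F (R (idx C)), f ⊆ B y) ∧
        (∀ y ∈ C \ {apex C}, ∀ z ∈ C \ {apex C}, y ≠ z → Disjoint (B y) (B z)) ∧
        ∀ y ∈ C \ {apex C}, ∀ z ∈ C \ {apex C}, X.Adj y z → Touches G (B y) (B z) := fun C => by
      by_cases hC : ∃ x ∈ s, C = compOn X s x
      · obtain ⟨x, hx, hCx⟩ := hC
        have hCs : C \ {apex C} ⊆ s := Set.sdiff_subset.trans (hCx ▸ compOn_subset)
        obtain ⟨B, hB⟩ := ih (hrich (idx C)) (happex C x hx hCx).2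
          ((Set.ncard_le_ncard hCs (Set.toFinite _)).trans hk)
        exact ⟨B, fun _ _ _ => hB⟩
      · exact ⟨fun _ => ∅, fun x hx h => absurd ⟨x, hx, h⟩ hC⟩
    choose B hB using hmodel
    set B' : U → Set V := fun x =>
      if x = apex (compOn X s x) then R (idx (compOn X s x)) else B (compOn X s x) x with hB'
    have hval : ∀ x ∈ s, x = apex (compOn X s x) ∧ B' x = R (idx (compOn X s x)) ∨
        x ∈ compOn X s x \ {apex (compOn X s x)} ∧ B' x = B (compOn X s x) x := fun x hx => by
      by_cases hxa : x = apex (compOn X s x)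
      · exact .inl ⟨hxa, if_pos hxa⟩
      · exact .inr ⟨⟨mem_compOn_self hx, hxa⟩, if_neg hxa⟩
    have hin : ∀ x ∈ s, B' x ⊆ K (idx (compOn X s x)) := fun x hx => by
      rcases hval x hx with ⟨-, h⟩ | ⟨hxC, h⟩ <;> rw [h]
      · exact hRK _
      · exact ((hB _ x hx rfl).1 x hxC).1.trans Set.sdiff_subset
    have htouch : ∀ x ∈ s, x ∈ compOn X s x \ {apex (compOn X s x)} →
        Touches G (B (compOn X s x) x) (R (idx (compOn X s x))) := fun x hx hxC => by
      obtain ⟨-, -, f, ⟨-, -, a, ha, b, hb, hab⟩, hfB⟩ := (hB _ x hx rfl).1 x hxC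
      exact ⟨a, hfB ha, b, hb, hab⟩
    refine ⟨B', fun x hx => ⟨(hin x hx).trans (hKA _), ?_⟩, fun x hx y hy hxy => ?_,
      fun x hx y hy hxy => ?_⟩
    · rcases hval x hx with ⟨-, h⟩ | ⟨hxC, h⟩ <;> rw [h]
      · exact ⟨hRc _, hRF _⟩
      · obtain ⟨-, hc, f, ⟨-, ⟨g, hg, hgf⟩, -⟩, hfB⟩ := (hB _ x hx rfl).1 x hxC
        exact ⟨hc, g, hg, hgf.trans hfB⟩
    · by_cases hi : idx (compOn X s x) = idx (compOn X s y)
      · have hC := hidx x hx y hy hi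
        rcases hval x hx with ⟨hxa, h⟩ | ⟨hxC, h⟩ <;> rcases hval y hy with ⟨hya, h'⟩ | ⟨hyC, h'⟩ <;>
          rw [h, h']
        · rw [← hC, ← hxa] at hya
          exact absurd hya.symm hxy
        · rw [hi]
          exact (Set.disjoint_sdiff_right).mono_right ((hB _ y hy rfl).1 y hyC).1
        · rw [← hi]
          exact (Set.disjoint_sdiff_left).mono_left ((hB _ x hx rfl).1 x hxC).1
        · rw [← hC] at hyC ⊢
          exact (hB _ x hx rfl).2.1 x hxC y hyC hxy
      · exact (hd _ _ hi).mono (hin x hx) (hin y hy)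
    · have hC : compOn X s y = compOn X s x :=
        compOn_eq_of_mem (compOn_closed (mem_compOn_self hx) hy hxy)
      rcases hval x hx with ⟨hxa, h⟩ | ⟨hxC, h⟩ <;> rcases hval y hy with ⟨hya, h'⟩ | ⟨hyC, h'⟩ <;>
        rw [h, h']
      · rw [hC, ← hxa] at hya
        exact absurd hya.symm hxy.ne
      · obtain ⟨a, ha, b, hb, hab⟩ := htouch y hy hyC
        rw [hC] at hb
        exact ⟨b, hb, a, ha, hab.symm⟩
      · rw [hC]
        exact htouch x hx hxC
      · rw [hC] at hyC ⊢
        exact (hB _ x hx rfl).2.2 x hxC y hyC hxy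

end Treedepth

/-! ### The induction on treedepth -/

section Induction

variable {V : Type u} {G : SimpleGraph V} {F : Set (Set V)} {A K Z S : Set V} {q B : ℕ}

theorem exists_hitting_of_root [Finite V] {v : V} (hv : v ∈ K) (hSK : S ⊆ K \ {v})
    (hF : ∀ f ∈ F, f ⊆ K \ {v} → (f ∩ S).Nonempty) (hS : ReachBounded G (K \ {v}) S q B) :
    ∃ S ⊆ K, (∀ f ∈ F, f ⊆ K → (f ∩ S).Nonempty) ∧ ReachBounded G K S q (1 + B) := by
  refine ⟨{v} ∪ S, Set.union_subset (by simpa using hv) (hSK.trans Set.sdiff_subset),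
    fun f hf hfK => ?_, by simpa using hS.union_first⟩
  by_cases hvf : v ∈ f
  · exact ⟨v, hvf, .inl rfl⟩
  · exact (hF f hf fun x hx => ⟨hfK hx, fun h => hvf (h ▸ hx)⟩).mono
      (Set.inter_subset_inter_right _ Set.subset_union_right)

theorem exists_hitting_of_components [Finite V] (hF : ∀ f ∈ F, ConnectedOn G f) (hZ : Z ⊆ A)
    (h : ∀ K ⊆ A \ Z, ConnectedOn G K →
      ∃ S ⊆ K, (∀ f ∈ F, f ⊆ K → (f ∩ S).Nonempty) ∧ ReachBounded G K S q B) :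
    ∃ S ⊆ A, (∀ f ∈ F, f ⊆ A → (f ∩ S).Nonempty) ∧ ReachBounded G A S q (Z.ncard + B) := by
  have h' : ∀ K : Set V, ∃ S ⊆ K, K ⊆ A \ Z → ConnectedOn G K →
      (∀ f ∈ F, f ⊆ K → (f ∩ S).Nonempty) ∧ ReachBounded G K S q B := fun K => by
    by_cases hK : K ⊆ A \ Z ∧ ConnectedOn G K
    · obtain ⟨S, hS, h⟩ := h K hK.1 hK.2
      exact ⟨S, hS, fun _ _ => h⟩
    · exact ⟨∅, Set.empty_subset _, fun h1 h2 => absurd ⟨h1, h2⟩ hK⟩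
  choose S hSK hS using h'
  refine ⟨Z ∪ {b | b ∈ A \ Z ∧ b ∈ S (compOn G (A \ Z) b)},
    Set.union_subset hZ fun x hx => hx.1.1, fun f hf hfA => ?_,
    (ReachBounded.of_components S hSK fun u hu =>
      (hS _ compOn_subset (connectedOn_compOn hu)).2).union_first⟩
  by_cases hfZ : (f ∩ Z).Nonempty
  · exact hfZ.mono (Set.inter_subset_inter_right _ Set.subset_union_left)
  obtain ⟨x, hx⟩ := (hF f hf).1
  have hfAZ : f ⊆ A \ Z := fun y hy => ⟨hfA hy, fun hyZ => hfZ ⟨y, hy, hyZ⟩⟩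
  have hfC := (hF f hf).subset_compOn hfAZ hx
  obtain ⟨y, hyf, hyS⟩ := (hS _ compOn_subset (connectedOn_compOn (hfAZ hx))).1 f hf hfC
  exact ⟨y, hyf, .inr ⟨hfAZ hyf, by rwa [compOn_eq_of_mem (hfC hyf)]⟩⟩

theorem exists_small_hitting [Finite V] {n k : ℕ} (hG : PackingBound G n)
    (hF : ∀ f ∈ F, ConnectedOn G f) (h : ¬ HasRichModel G k 1 F A) :
    ∃ Z ⊆ A, Z.ncard ≤ k * n ∧ ∀ f ∈ F, f ⊆ A → (f ∩ Z).Nonempty := by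
  obtain ⟨Z, hZA, hZ, hcone⟩ := exists_hitting_of_not_hasRichModel hG h
  refine ⟨Z, hZA, hZ, fun f hf hfA => ?_⟩
  by_contra hfZ
  exact hcone f (fun x hx => ⟨hfA hx, fun hxZ => hfZ ⟨x, hx, hxZ⟩⟩) (hF f hf)
    ⟨f, le_rfl, hF f hf, ⟨f, hf, le_rfl⟩, trivial⟩

end Induction

/-- For each `k`, in a graph with packing bound `n` and without a rich model of height `s + 2`, the
family `F` has a hitting set of reach bound `O(n r ^ s log r)`. -/
def HittingBound (s : ℕ) : Prop :=
  ∀ k : ℕ, ∃ c : ℕ, ∀ (V : Type u) [Finite V] (G : SimpleGraph V) (n : ℕ), 1 ≤ n →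
    PackingBound G n → ∀ F : Set (Set V), (∀ f ∈ F, ConnectedOn G f) → ∀ A : Set V,
      ¬ HasRichModel G k (s + 2) F A → ∀ r : ℕ, 2 ≤ r →
        ∃ S ⊆ A, (∀ f ∈ F, f ⊆ A → (f ∩ S).Nonempty) ∧
          ReachBounded G A S (r + 1) (c * n * (r ^ s * Nat.log 2 r))

theorem hittingBound_zero : HittingBound.{u} 0 := by
  intro k
  refine ⟨9 * (k + 1), fun V _ G n hn hG F hF A hrich r hr => ?_⟩
  obtain ⟨Z, hZA, hZ, hcone⟩ := exists_hitting_of_not_hasRichModel hG hrich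
  set M := Nat.log 2 (r + 1) + 1 with hM
  have hcomp : ∀ K ⊆ A \ Z, ConnectedOn G K → ∃ S ⊆ K, (∀ f ∈ F, f ⊆ K → (f ∩ S).Nonempty) ∧
      ReachBounded G K S (r + 1) (1 + 2 * (M + 1) * ((k + 1) * n)) := by
    intro K hK hKc
    obtain ⟨v, hv⟩ := hKc.1
    have hroot : K \ (K \ {v}) = {v} := by simpa using hv
    obtain ⟨S, δ, hl, hB⟩ := exists_layered_of_ncard_le (B := (k + 1) * n) hKc hF
      (fun E hEK hR => by
        have := fun h => hcone K hK hKc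
          (hasCone_of_hasRichModel_attached (K := K) hR Set.sdiff_subset h)
        rw [Set.sdiff_sdiff_cancel_left hEK] at this
        obtain ⟨S, hSE, hS, hSF⟩ := exists_small_hitting hG (fun f hf => hf.1) this
        exact ⟨S, hSE, hS, hSF⟩) _ (K \ {v}) Set.sdiff_subset
      (by rw [hroot]; exact connectedOn_singleton v) rfl
    exact exists_hitting_of_root hv hl.subset hl.hits
      (hl.reachBounded_of_dyadic hB (Nat.lt_pow_succ_log_self (by norm_num) _))
  obtain ⟨S, hSA, hSF, hS⟩ := exists_hitting_of_components hF hZA hcomp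
  refine ⟨S, hSA, hSF, hS.mono ?_⟩
  have hlog : 1 ≤ Nat.log 2 r := Nat.log_pos (by norm_num) hr
  have hlog' : M ≤ Nat.log 2 r + 2 := by
    have : Nat.log 2 (r + 1) ≤ Nat.log 2 (r * 2) := Nat.log_mono_right (by omega)
    rw [Nat.log_mul_base (by norm_num) (by omega)] at this
    omega
  set ℓ := Nat.log 2 r with hℓ
  have h1 : 2 * (M + 1) * ((k + 1) * n) ≤ 8 * ℓ * ((k + 1) * n) := Nat.mul_le_mul_right _ (by omega)
  have h2 : Z.ncard + 1 ≤ (k + 1) * n := by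
    rw [Nat.add_mul, Nat.one_mul]
    omega
  have h3 : (k + 1) * n ≤ ℓ * ((k + 1) * n) := Nat.le_mul_of_pos_left _ hlog
  calc Z.ncard + (1 + 2 * (M + 1) * ((k + 1) * n))
      ≤ ℓ * ((k + 1) * n) + 8 * ℓ * ((k + 1) * n) := by omega
    _ = 9 * (k + 1) * n * (r ^ 0 * ℓ) := by ring

theorem HittingBound.succ {s : ℕ} (h : HittingBound.{u} s) : HittingBound.{u} (s + 1) := by
  intro k
  obtain ⟨c, hc⟩ := h (k + 1)
  refine ⟨k + 1 + 2 * c, fun V _ G n hn hG F hF A hrich r hr => ?_⟩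
  obtain ⟨Z, hZA, hZ, hcone⟩ := exists_hitting_of_not_hasRichModel hG hrich
  set g := r ^ s * Nat.log 2 r with hg
  have hcomp : ∀ K ⊆ A \ Z, ConnectedOn G K → ∃ S ⊆ K, (∀ f ∈ F, f ⊆ K → (f ∩ S).Nonempty) ∧
      ReachBounded G K S (r + 1) (1 + (r + 1 + 1) * (c * n * g)) := by
    intro K hK hKc
    obtain ⟨v, hv⟩ := hKc.1
    have hroot : K \ (K \ {v}) = {v} := by simpa using hv
    obtain ⟨S, δ, κ, hl, hB, hle⟩ := exists_layered_of_reachBounded (q := r + 1) (B := c * n * g)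
      hKc hF (fun E hEK hR => by
        have := fun h => hcone K hK hKc
          (hasCone_of_hasRichModel_attached (K := K) hR Set.sdiff_subset h)
        rw [Set.sdiff_sdiff_cancel_left hEK] at this
        exact hc V G n hn hG _ (fun f hf => hf.1) E this r hr) _ (K \ {v}) Set.sdiff_subset
      (by rw [hroot]; exact connectedOn_singleton v) rfl
    exact exists_hitting_of_root hv hl.subset hl.hits (hl.reachBounded_of_levels hB hle)
  obtain ⟨S, hSA, hSF, hS⟩ := exists_hitting_of_components hF hZA hcomp
  refine ⟨S, hSA, hSF, hS.mono ?_⟩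
  have hpos : 1 ≤ r * g :=
    Nat.mul_pos (by omega) (Nat.mul_pos (Nat.pow_pos (by omega)) (Nat.log_pos (by norm_num) hr))
  have h1 : (r + 1 + 1) * (c * n * g) ≤ 2 * r * (c * n * g) := Nat.mul_le_mul_right _ (by omega)
  have h2 : Z.ncard + 1 ≤ (k + 1) * n := by
    rw [Nat.add_mul, Nat.one_mul]
    omega
  have h3 : (k + 1) * n ≤ (k + 1) * n * (r * g) := Nat.le_mul_of_pos_right _ hpos
  calc Z.ncard + (1 + (r + 1 + 1) * (c * n * g))
      ≤ (k + 1) * n * (r * g) + 2 * r * (c * n * g) := by omega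
    _ = (k + 1 + 2 * c) * n * (r ^ (s + 1) * Nat.log 2 r) := by rw [hg]; ring

theorem hittingBound (s : ℕ) : HittingBound.{u} s := by
  induction s with
  | zero => exact hittingBound_zero
  | succ s ih => exact ih.succ

/-! ### Weak coloring numbers and treewidth -/

section Final

variable {V : Type u} {G : SimpleGraph V}

theorem wcol_le_of_reachBounded [Finite V] {r B : ℕ}
    (h : ReachBounded G Set.univ Set.univ (r + 1) B) : wcol G r ≤ B := by
  classical
  obtain ⟨κ, hκ⟩ := h
  obtain ⟨N, ⟨e⟩⟩ := Finite.exists_equiv_fin V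
  -- Ties between keys are broken by an arbitrary enumeration of the vertices.
  let σ : LinearOrder V := LinearOrder.lift' (fun x => toLex (κ x, e x)) fun x y hxy =>
    e.injective (congrArg (fun z => (ofLex z).2) hxy)
  have hσ : ∀ x y : V, σ.le x y → κ x ≤ κ y := fun x y hxy => by
    have hxy : toLex (κ x, e x) ≤ toLex (κ y, e y) := hxy
    rw [Prod.Lex.toLex_le_toLex] at hxy
    exact hxy.elim le_of_lt fun h => h.1.le
  refine (ciInf_le ⟨0, fun _ _ => Nat.zero_le _⟩ σ).trans (ciSup_le' fun a => ?_)
  refine (Set.ncard_le_ncard ?_ (Set.toFinite _)).trans (hκ a)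
  rintro b ⟨p, -, hlen, hp⟩
  have hpA : ∀ w ∈ p.support, w ∈ Set.univ \ {w | w ∈ Set.univ ∧ κ w < κ b} := fun w hw =>
    ⟨trivial, fun hlt => absurd (hσ _ _ (hp w hw)) (not_le.2 hlt.2)⟩
  exact ⟨trivial, (Reach.of_walk p hpA).mono le_rfl le_rfl (Nat.succ_le_succ hlen)⟩

theorem isMinor_of_hasRichModel {U : Type w} [Finite U] {X : SimpleGraph U} {t : ℕ}
    {F : Set (Set V)} (hX : treedepth X ≤ t) (h : HasRichModel G (Nat.card U) t F Set.univ) :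
    IsMinor X G := by
  obtain ⟨B, hB, hd, hadj⟩ := h.exists_model (X := X) (s := Set.univ) hX (by simp)
  exact ⟨B, fun x y hxy => hd x trivial y trivial hxy, fun x => connectedOn_iff.1 (hB x trivial).2.1,
    fun x y hxy => hadj x trivial y trivial hxy⟩

theorem exists_isTreeDecomposition_width_eq [Finite V] (G : SimpleGraph V) :
    ∃ (n : ℕ) (T : SimpleGraph (Fin n)) (W : Fin n → Set V),
      IsTreeDecomposition G T W ∧ width W = treewidth G := by
  refine Int.csInf_mem (s := {k : ℤ | ∃ (n : ℕ) (T : SimpleGraph (Fin n)) (W : Fin n → Set V),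
    IsTreeDecomposition G T W ∧ width W = k}) ?_ ?_
  · -- The tree with one vertex whose bag is the whole vertex set.
    have hT : (⊥ : SimpleGraph (Fin 1)).IsTree := .of_subsingleton
    refine ⟨width fun _ : Fin 1 => (Set.univ : Set V), 1, ⊥, fun _ => Set.univ,
      ⟨hT, fun a => ?_, fun a b _ => ⟨0, trivial, trivial⟩⟩, rfl⟩
    refine connectedOn_iff.1 ⟨⟨0, trivial⟩, fun x _ y _ => ?_⟩
    obtain rfl := Subsingleton.elim x y
    exact .refl trivial
  · refine ⟨-1, ?_⟩
    rintro _ ⟨n, T, W, -, rfl⟩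
    simp only [width]
    omega

end Final

end WeakColoring

open WeakColoring in
theorem mainTheorem4 (t : ℕ) (ht : 2 ≤ t) (U : Type*) [Finite U] (X : SimpleGraph U)
    (hX : WeakColoring.treedepth X ≤ t) :
    ∃ c : ℤ, ∀ (V : Type*) [Finite V] (G : SimpleGraph V), ¬ WeakColoring.IsMinor X G →
      ∀ r : ℕ, 2 ≤ r →
        (WeakColoring.wcol G r : ℝ) ≤
          (c : ℝ) * ((WeakColoring.treewidth G : ℝ) + 1) * (r : ℝ) ^ (t - 2) * Real.log (r : ℝ) := by
  obtain ⟨s, rfl⟩ : ∃ s, t = s + 2 := ⟨t - 2, by omega⟩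
  obtain ⟨c, hc⟩ := hittingBound s (Nat.card U)
  refine ⟨2 * c, fun V _ G hG r hr => ?_⟩
  obtain ⟨m, T, W, hTW, hwidth⟩ := exists_isTreeDecomposition_width_eq G
  set n := ⨆ x : Fin m, (W x).ncard with hn
  have hW : ∀ x, (W x).ncard ≤ n := fun x =>
    le_ciSup (f := fun x => (W x).ncard) (Set.toFinite _).bddAbove x
  have htw : (treewidth G : ℝ) + 1 = n := by
    rw [← hwidth, width]
    push_cast
    ring
  have hbound : wcol G r ≤ c * n * (r ^ s * Nat.log 2 r) := by
    rcases isEmpty_or_nonempty V with hV | ⟨⟨a⟩⟩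
    · refine (wcol_le_of_reachBounded ⟨fun _ => 0, fun u => isEmptyElim u⟩).trans (Nat.zero_le _)
    have hn1 : 1 ≤ n := by
      obtain ⟨⟨x, hx⟩⟩ := (hTW.connected a).nonempty
      exact ((Set.ncard_pos (Set.toFinite _)).2 ⟨a, hx⟩).trans_le (hW x)
    obtain ⟨S, -, hSF, hS⟩ := hc V G n hn1 (hTW.packingBound hW) (Set.range fun v : V => {v})
      (by rintro _ ⟨v, rfl⟩; exact connectedOn_singleton v) Set.univ
      (fun h => hG (isMinor_of_hasRichModel hX h)) r hr
    have hSuniv : S = Set.univ := Set.eq_univ_of_forall fun v => by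
      obtain ⟨x, hx, hxS⟩ := hSF {v} ⟨v, rfl⟩ (Set.subset_univ _)
      obtain rfl : x = v := hx
      exact hxS
    exact wcol_le_of_reachBounded (hSuniv ▸ hS)
  have hlog : (Nat.log 2 r : ℝ) ≤ 2 * Real.log r := by
    have h1 : (Nat.log 2 r : ℝ) * Real.log 2 ≤ Real.log r := by
      rw [← Real.log_pow]
      refine Real.log_le_log (by positivity) ?_
      exact_mod_cast Nat.pow_log_le_self 2 (by omega)
    have h2 := Real.log_two_gt_d9
    nlinarith [(Nat.cast_nonneg (Nat.log 2 r) : (0 : ℝ) ≤ _)]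
  rw [htw, Nat.add_sub_cancel]
  calc (wcol G r : ℝ) ≤ c * n * (r ^ s * Nat.log 2 r) := by exact_mod_cast hbound
    _ ≤ c * n * (r ^ s * (2 * Real.log r)) := by gcongr
    _ = ((2 * c : ℤ) : ℝ) * n * r ^ s * Real.log r := by push_cast; ring
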